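/- **Setting.** Let $T>0$, $\Theta=[0,1]\times\mathbb R^2\times\mathbb R^3\ni(x,\xi,v)$ with $v=(v_x,v_y,v_z)$, $\underline v=(v_y,v_z)$, and let $d\omega$ be the surface measure of the unit sphere $S^2\subset\mathbb R^3$ (total mass $4\pi$), $\underline\omega=(\omega_y,\omega_z)$. Let $B\colon\mathbb R^2\to\mathbb R$ be continuous, $C\in L^1_{loc}(\mathbb R^2)$, and let $F_I(\xi,\varepsilon)$ be such that $f_I(x,\xi,v)=F_I(\xi,|v|^2/2)$ belongs to $L^2(\Theta)$. A direction or velocity is called outgoing (incoming) at the plate $x=0$ if its $x$-component is negative (positive), and at the plate $x=1$ if its $x$-component is positive (negative). Let $K(\xi,\varepsilon;\omega'\to\omega)$ be a measurable kernel which, for all $\xi$, all $\varepsilon>0$ and both plates, satisfies $K\ge0$ for almost all outgoing $\omega'$ and incoming $\omega$, and $\int_{\omega\ \mathrm{incoming}}K(\xi,\varepsilon;\omega'\to\omega)|\omega_x|\,d\omega=1$ for almost all outgoing $\omega'$. Put $$(\mathcal K u)(v)=\int_{\omega'\ \mathrm{outgoing}}K\big(\xi,\tfrac{|v|^2}2;\omega'\to\tfrac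 v{|v|}\big)\,u(|v|\omega')\,|\omega'_x|\,d\omega'.$$ For $\alpha>0$, a *solution of the problem $(P)$* on $(0,T)$ consists of $f^\alpha(t,x,\xi,v)$, $\phi^\alpha(t,\xi)$ and $E^\alpha=-\nabla_\xi\phi^\alpha$ such that $$\alpha\,\partial_tf^\alpha+\mathcal A^\alpha f^\alpha=0,\qquad \mathcal A^\alpha f=\underline v\cdot\nabla_\xi f+E^\alpha\cdot\nabla_{\underline v}f+\tfrac1\alpha\big(v_x\partial_xf-B(\xi)(v_z\partial_{v_y}-v_y\partial_{v_z})f\big),$$ $$-\Delta_\xi\phi^\alpha=\int_0^1\!\!\int_{\mathbb R^3}f^\alpha\,dv\,dx-C,\qquad \gamma^-(f^\alpha)=\mathcal K\gamma^+(f^\alpha)\ \text{at } x=0,1,\qquad f^\alpha|_{t=0}=f_I,$$ in the following sense: $f^\alpha$ and $\mathcal A^\alpha f^\alpha$ (in the sense of distributions) belong to $L^\infty(0,T;L^2(\Theta))$; $E^\alpha\in L^2(0,T;L^2_{loc}(\mathbb R^2))$; $f^\alpha(t)=f_I-\frac1\alpha\int_0^t\mathcal A^\alpha f^\alpha(s)\,ds$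 almost everywhere; $f^\alpha$ has traces on the plates (characterized, for almost every $t$, by Green's formula for $\mathcal A^\alpha$ against $C^1$ functions with compact support in $\Theta$) that are square integrable with respect to $|v_x|\,dt\,d\xi\,dv$ on $\{|v|\le R\}$ for every $R$, and whose outgoing and incoming parts $\gamma^\pm(f^\alpha)$ satisfy the boundary condition almost everywhere; and, for almost every $t$, $f^\alpha(t)$ is integrable on $[0,1]\times\{|\xi|<R\}\times\mathbb R^3$ for every $R$, $\phi^\alpha(t)\in L^1_{loc}(\mathbb R^2)$, and $E^\alpha=-\nabla_\xi\phi^\alpha$ and the Poisson equation hold in the sense of distributions. For such a solution put $$F^\alpha(\xi,\varepsilon,t)=\frac1{4\pi}\int_0^1\!\!\int_{S^2}f^\alpha(t,x,\xi,\sqrt{2\varepsilon}\,\omega)\,d\omega\,dx,\qquad J^\alpha(\xi,\varepsilon,t)=\frac{2\varepsilon}\alpha\int_0^1\!\!\int_{S^2}\underline\omega\,f^\alpha(t,x,\xi,\sqrt{2\varepsilon}\,\omega)\,d\omega\,dx .$$ A *test function* is a function $\psi(\xi,\varepsilon,t)$ that is the restriction of a $C^2$ function on $\mathbb R^2\times\mathbb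 R\times\mathbb R$ with compact support in $\mathbb R^2\times\mathbb R\times(-\infty,T)$; it thus has compact support in $\mathbb R^2\times[0,\infty)\times[0,T)$ and need not vanish at $\varepsilon=0$ or at $t=0$. **Lemma.** (1) For every $\alpha>0$, every solution of $(P)$ and every test function $\psi$, both integrals below converge absolutely and $$\int_0^T\!\!\int_{\mathbb R^2\times(0,\infty)}\Big(4\pi\sqrt{2\varepsilon}\,F^\alpha\,\partial_t\psi+J^\alpha\cdot\big(\nabla_\xi+E^\alpha\partial_\varepsilon\big)\psi\Big)\,d\xi\,d\varepsilon\,dt+\int_{\mathbb R^2\times(0,\infty)}4\pi\sqrt{2\varepsilon}\,F_I\,\psi|_{t=0}\,d\xi\,d\varepsilon=0 .$$ (2) Let $\alpha_n>0$, $\alpha_n\to0$, and let $(f^{\alpha_n},\phi^{\alpha_n},E^{\alpha_n})$ be solutions of $(P)$ with the same $K,B,C,F_I$ such that, as $n\to\infty$, $f^{\alpha_n}\to f^0$ weakly-$*$ in $L^\infty(0,T;L^2(\Theta))$, $J^{\alpha_n}\to J$ weakly in $L^2(\{|\xi|<R\}\times(0,R)\times(0,T))$ for every $R$, and $E^{\alpha_n}\to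 E$ strongly in $L^2(0,T;L^2_{loc}(\mathbb R^2))$. Put $F=\frac1{4\pi}\int_0^1\int_{S^2}f^0(t,x,\xi,\sqrt{2\varepsilon}\,\omega)\,d\omega\,dx$. Then $F$ and $J$ satisfy the continuity equation $$4\pi\sqrt{2\varepsilon}\,\partial_tF+\big(\nabla_\xi+E\,\partial_\varepsilon\big)\cdot J=0,\qquad F|_{t=0}=F_I,$$ weakly: for every test function $\psi$ the identity of (1) holds, with absolutely convergent integrals, with $(F^\alpha,J^\alpha,E^\alpha)$ replaced by $(F,J,E)$. -/

import Mathlib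

open MeasureTheory Set Filter Topology

noncomputable section

namespace SHE

/-- Position `ξ = (y, z)` parallel to the plates. -/
abbrev Pos := EuclideanSpace ℝ (Fin 2)

/-- Velocity `v = (v_x, v_y, v_z)`; the index `0` is the direction perpendicular to the plates. -/
abbrev Vel := EuclideanSpace ℝ (Fin 3)

/-- Phase-space points `(x, ξ, v)`; the phase space `Θ` is the part `0 ≤ x ≤ 1`. -/
abbrev Phase := ℝ × Pos × Vel

/-- The unit sphere `S²` of velocity directions. -/
abbrev Dir := Metric.sphere (0 : Vel) 1

/-- The volume `dθ = dx dξ dv` on `Θ`. -/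
def phaseMeasure : Measure Phase := volume.restrict (Icc (0 : ℝ) 1 ×ˢ univ)

/-- The surface measure `dω` of the unit sphere (total mass `4π`). -/
def surface : Measure Dir := (volume : Measure Vel).toSphere

/-- The component `(v_y, v_z)` of a velocity parallel to the plates. -/
def par (v : Vel) : Pos := !₂[v 1, v 2]

/-- The parallel vector `(E_y, E_z)` seen as the velocity-space vector `(0, E_y, E_z)`. -/
def lift (e : Pos) : Vel := !₂[0, e 0, e 1]

/-- `v × B` for the magnetic field `(1, 0, 0)`, that is `(0, v_z, -v_y)`. -/
def crossX (v : Vel) : Vel := !₂[0, v 2, -(v 1)]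

/-- The vector field on phase space whose directional derivative is
`v·∇_ξ + E·∇_v + α⁻¹ (v_x ∂_x - (v × B)·∇_v)`. -/
def transportField (α : ℝ) (E : Pos → Pos) (B : Pos → ℝ) (p : Phase) : Phase :=
  (α⁻¹ * p.2.2 0, par p.2.2, lift (E p.2.1) - (α⁻¹ * B p.2.1) • crossX p.2.2)

/-- The transport operator `v·∇_ξ + E·∇_v + α⁻¹ (v_x ∂_x - (v × B)·∇_v)` on `C¹` functions. -/
def transport (α : ℝ) (E : Pos → Pos) (B : Pos → ℝ) (ψ : Phase → ℝ) (p : Phase) : ℝ :=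
  fderiv ℝ ψ p (transportField α E B p)

/-- The two plates are `x = 0` (index `0`) and `x = 1` (index `1`). -/
def plate (i : Fin 2) : ℝ := if i = 0 then 0 else 1

/-- The `x`-component of the outward normal on a plate. -/
def normal (i : Fin 2) : ℝ := if i = 0 then -1 else 1

/-- Velocities that leave the slab through plate `i`. -/
def Outgoing (i : Fin 2) (v : Vel) : Prop := 0 < normal i * v 0

/-- Velocities that enter the slab through plate `i`. -/
def Incoming (i : Fin 2) (v : Vel) : Prop := normal i * v 0 < 0

/-- A reflection kernel `K(ξ, ε; ω' → ω)`, written `K ξ ε ω' ω`: nonnegative, and with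
conservation of the normal flux. Only its values on unit vectors `ω'`, `ω` that are outgoing,
respectively incoming, at the same plate matter. -/
structure IsReflectionKernel (K : Pos → ℝ → Vel → Vel → ℝ) : Prop where
  measurable : Measurable fun p : Pos × ℝ × Vel × Vel => K p.1 p.2.1 p.2.2.1 p.2.2.2
  nonneg : ∀ (ξ : Pos) (ε : ℝ), 0 < ε → ∀ i : Fin 2,
    ∀ᵐ q : Dir × Dir ∂(surface.prod surface),
      Outgoing i q.1 → Incoming i q.2 → 0 ≤ K ξ ε q.1 q.2
  flux : ∀ (ξ : Pos) (ε : ℝ), 0 < ε → ∀ i : Fin 2,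
    ∀ᵐ ω' : Dir ∂surface, Outgoing i ω' →
      ∫ ω in {ω : Dir | Incoming i ω}, K ξ ε ω' ω * |(ω : Vel) 0| ∂surface = 1

/-- The boundary operator at plate `i` applied to a trace `u`:
`(𝒦 u)(v) = ∫_{ω' outgoing} K(ξ, |v|²/2; ω' → v/|v|) u(|v| ω') |ω'_x| dω'`. -/
def boundaryOp (K : Pos → ℝ → Vel → Vel → ℝ) (i : Fin 2) (ξ : Pos) (u : Vel → ℝ) (v : Vel) : ℝ :=
  ∫ ω' in {ω' : Dir | Outgoing i ω'},
    K ξ (‖v‖ ^ 2 / 2) ω' (‖v‖⁻¹ • v) * u (‖v‖ • (ω' : Vel)) * |(ω' : Vel) 0| ∂surface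

/-- `f ∈ L^∞(0, T; L²(Θ))`. -/
def MemLinftyL2 (T : ℝ) (f : ℝ → Phase → ℝ) : Prop :=
  AEStronglyMeasurable (fun q : ℝ × Phase => f q.1 q.2)
      ((volume.restrict (Ioo 0 T)).prod phaseMeasure) ∧
    ∃ c : NNReal, ∀ᵐ t ∂(volume.restrict (Ioo 0 T)), eLpNorm (f t) 2 phaseMeasure ≤ c

/-- `E ∈ L²(0, T; L²_loc(ℝ²))`. -/
def MemL2L2loc (T : ℝ) (E : ℝ → Pos → Pos) : Prop :=
  ∀ R : ℝ, MemLp (fun q : ℝ × Pos => E q.1 q.2) 2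
    (volume.restrict (Ioo 0 T ×ˢ Metric.ball 0 R))

/-- `h = 𝒜^α f` in `Θ` (in the sense of distributions), and `g` is the trace of `f` on the two
plates: Green's formula holds against every `C¹` function with compact support
in `[0,1] × ℝ² × ℝ³`. Here `g i (ξ, v)` is the value of the trace on plate `i`. -/
def HasTransportAndTrace (α : ℝ) (E : Pos → Pos) (B : Pos → ℝ)
    (f h : Phase → ℝ) (g : Fin 2 → Pos × Vel → ℝ) : Prop :=
  ∀ ψ : Phase → ℝ, ContDiff ℝ 1 ψ → HasCompactSupport ψ →
    (∫ p, h p * ψ p ∂phaseMeasure) + ∫ p, f p * transport α E B ψ p ∂phaseMeasure =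
      α⁻¹ * ∑ i : Fin 2, normal i * ∫ q : Pos × Vel, q.2 0 * g i q * ψ (plate i, q)

/-- The spatial density `∫₀¹ ∫_{ℝ³} f dx dv`. -/
def spatialDensity (f : Phase → ℝ) (ξ : Pos) : ℝ :=
  ∫ y : ℝ × Vel, f (y.1, ξ, y.2) ∂((volume.restrict (Icc (0 : ℝ) 1)).prod volume)

/-- `E = -∇φ` and `-Δφ = ∫₀¹ ∫_{ℝ³} f dx dv - C` on `ℝ²`, in the sense of distributions. -/
structure SolvesPoisson (C : Pos → ℝ) (f : Phase → ℝ) (φ : Pos → ℝ) (E : Pos → Pos) : Prop where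
  potential : LocallyIntegrable φ
  density : ∀ R : ℝ, IntegrableOn f
    (Icc (0 : ℝ) 1 ×ˢ Metric.ball (0 : Pos) R ×ˢ (univ : Set Vel))
  gradient : ∀ η : Pos → ℝ, ContDiff ℝ (⊤ : ℕ∞) η → HasCompactSupport η → ∀ j : Fin 2,
    ∫ ξ, φ ξ * fderiv ℝ η ξ (EuclideanSpace.single j 1) = ∫ ξ, E ξ j * η ξ
  poisson : ∀ η : Pos → ℝ, ContDiff ℝ (⊤ : ℕ∞) η → HasCompactSupport η →
    ∫ ξ, fderiv ℝ η ξ (E ξ) = -∫ ξ, (spatialDensity f ξ - C ξ) * η ξ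

/-- The isotropic initial datum `f_I(x, ξ, v) = F_I(ξ, |v|²/2)`. -/
def initialDatum (FI : Pos → ℝ → ℝ) (p : Phase) : ℝ := FI p.2.1 (‖p.2.2‖ ^ 2 / 2)

/-- `f` (with potential `φ` and field `E = -∇φ`) solves, on `(0, T)`, the scaled
Vlasov–Poisson initial boundary value problem
`α ∂ₜf + v·∇_ξ f + E·∇_v f + α⁻¹ (v_x ∂_x f - (v × B)·∇_v f) = 0`, `-Δφ = ∫∫ f dx dv - C`,
`γ⁻(f) = 𝒦 γ⁺(f)`, `f(0) = F_I(ξ, |v|²/2)`, in the class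
`f, 𝒜^α f ∈ L^∞(0, T; L²(Θ))`, with traces that are square integrable against
`|v_x| dt dξ dv` on `{|v| ≤ R}` for every `R`. The function `h` is `𝒜^α f`, and `evolution` says
`α ∂ₜf + h = 0`, `f(0) = f_I`. -/
structure IsSolution (α T : ℝ) (K : Pos → ℝ → Vel → Vel → ℝ) (B C : Pos → ℝ) (FI : Pos → ℝ → ℝ)
    (f : ℝ → Phase → ℝ) (φ : ℝ → Pos → ℝ) (E : ℝ → Pos → Pos) : Prop where
  memLp : MemLinftyL2 T f
  field : MemL2L2loc T E
  poisson : ∀ᵐ t ∂(volume.restrict (Ioo 0 T)), SolvesPoisson C (f t) (φ t) (E t)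
  vlasov : ∃ (h : ℝ → Phase → ℝ) (g : ℝ → Fin 2 → Pos × Vel → ℝ),
    MemLinftyL2 T h ∧
    -- evolution
    (∀ᵐ q : ℝ × Phase ∂((volume.restrict (Ioo 0 T)).prod phaseMeasure),
      f q.1 q.2 = initialDatum FI q.2 - α⁻¹ * ∫ s in (0 : ℝ)..q.1, h s q.2) ∧
    -- transport and traces
    (∀ᵐ t ∂(volume.restrict (Ioo 0 T)), HasTransportAndTrace α (E t) B (f t) (h t) (g t)) ∧
    (∀ i, AEStronglyMeasurable (fun q : ℝ × Pos × Vel => g q.1 i q.2)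
      (volume.restrict (Ioo 0 T ×ˢ univ))) ∧
    (∀ (i : Fin 2) (R : ℝ),
      ∫⁻ q in Ioo 0 T ×ˢ {q : Pos × Vel | ‖q.2‖ ≤ R},
        ENNReal.ofReal (|q.2.2 0| * g q.1 i q.2 ^ 2) < ⊤) ∧
    -- boundary condition
    (∀ i, ∀ᵐ q : ℝ × Pos × Vel ∂(volume.restrict (Ioo 0 T ×ˢ univ)), Incoming i q.2.2 →
      g q.1 i q.2 = boundaryOp K i q.2.1 (fun v => g q.1 i (q.2.1, v)) q.2.2)

/-- The measure `dx dω` on `[0,1] × S²`. -/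
def slabSphere : Measure (ℝ × Dir) := (volume.restrict (Icc (0 : ℝ) 1)).prod surface

/-- The average density `F(ξ, ε, t) = (4π)⁻¹ ∫₀¹ ∫_{S²} f(x, ξ, √(2ε) ω, t) dx dω`. -/
def avgDensity (f : ℝ → Phase → ℝ) (ξ : Pos) (ε t : ℝ) : ℝ :=
  (4 * Real.pi)⁻¹ * ∫ y, f t (y.1, ξ, √(2 * ε) • (y.2 : Vel)) ∂slabSphere

/-- The current `J(ξ, ε, t) = (2ε/α) ∫₀¹ ∫_{S²} (ω_y, ω_z) f(x, ξ, √(2ε) ω, t) dx dω`. -/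
def current (α : ℝ) (f : ℝ → Phase → ℝ) (ξ : Pos) (ε t : ℝ) : Pos :=
  (2 * ε / α) • ∫ y, f t (y.1, ξ, √(2 * ε) • (y.2 : Vel)) • par (y.2 : Vel) ∂slabSphere

/-- `C²` test functions `ψ(ξ, ε, t)` with compact support in `ℝ² × [0, ∞) × [0, T)`, given as
restrictions of functions on `ℝ² × ℝ × ℝ`. They need not vanish at `ε = 0` or at `t = 0`. -/
structure IsTest (T : ℝ) (ψ : Pos × ℝ × ℝ → ℝ) : Prop where
  contDiff : ContDiff ℝ 2 ψ
  compact : HasCompactSupport ψ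
  support : tsupport ψ ⊆ {p | p.2.2 < T}

/-- The integrand `4π √(2ε) F ∂ₜψ + J·(∇_ξ + E ∂_ε)ψ` at the point `p = (ξ, ε, t)`. -/
def weakIntegrand (F : Pos → ℝ → ℝ → ℝ) (J : Pos → ℝ → ℝ → Pos) (E : ℝ → Pos → Pos)
    (ψ : Pos × ℝ × ℝ → ℝ) (p : Pos × ℝ × ℝ) : ℝ :=
  4 * Real.pi * √(2 * p.2.1) * F p.1 p.2.1 p.2.2 * fderiv ℝ ψ p (0, 0, 1) +
    (fderiv ℝ ψ p (J p.1 p.2.1 p.2.2, 0, 0) +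
      inner ℝ (J p.1 p.2.1 p.2.2) (E p.2.2 p.1) * fderiv ℝ ψ p (0, 1, 0))

/-- Weak form, with initial datum `F_I` and no flux through `ε = 0`, of the continuity equation
`4π √(2ε) ∂ₜF + (∇_ξ + E ∂_ε)·J = 0` for `ξ ∈ ℝ²`, `ε > 0`, `0 < t < T`. -/
def WeakContinuityEq (T : ℝ) (F : Pos → ℝ → ℝ → ℝ) (J : Pos → ℝ → ℝ → Pos)
    (E : ℝ → Pos → Pos) (FI : Pos → ℝ → ℝ) : Prop :=
  ∀ ψ : Pos × ℝ × ℝ → ℝ, IsTest T ψ →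
    IntegrableOn (weakIntegrand F J E ψ) (univ ×ˢ Ioi 0 ×ˢ Ioo 0 T) ∧
    IntegrableOn (fun p : Pos × ℝ => 4 * Real.pi * √(2 * p.2) * FI p.1 p.2 * ψ (p.1, p.2, 0))
      (univ ×ˢ Ioi 0) ∧
    (∫ p in univ ×ˢ Ioi 0 ×ˢ Ioo 0 T, weakIntegrand F J E ψ p) +
      ∫ p : Pos × ℝ in univ ×ˢ Ioi 0,
        4 * Real.pi * √(2 * p.2) * FI p.1 p.2 * ψ (p.1, p.2, 0) = 0

/-- `fₙ → f` weak-star in `L^∞(0, T; L²(Θ))`, the dual of `L¹(0, T; L²(Θ))`. -/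
def WeakStarTendsto (T : ℝ) (fs : ℕ → ℝ → Phase → ℝ) (f : ℝ → Phase → ℝ) : Prop :=
  MemLinftyL2 T f ∧
    ∀ u : ℝ → Phase → ℝ,
      AEStronglyMeasurable (fun q : ℝ × Phase => u q.1 q.2)
        ((volume.restrict (Ioo 0 T)).prod phaseMeasure) →
      ∫⁻ t in Ioo 0 T, eLpNorm (u t) 2 phaseMeasure < ⊤ →
      Tendsto (fun n => ∫ q : ℝ × Phase, fs n q.1 q.2 * u q.1 q.2
          ∂((volume.restrict (Ioo 0 T)).prod phaseMeasure)) atTop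
        (𝓝 (∫ q : ℝ × Phase, f q.1 q.2 * u q.1 q.2
          ∂((volume.restrict (Ioo 0 T)).prod phaseMeasure)))

/-- `Jₙ → J` weakly in `L²({|ξ| < R} × (0, R) × (0, T))` for every `R`. -/
def WeakL2locTendsto (T : ℝ) (Js : ℕ → Pos → ℝ → ℝ → Pos) (J : Pos → ℝ → ℝ → Pos) : Prop :=
  ∀ R : ℝ,
    MemLp (fun p : Pos × ℝ × ℝ => J p.1 p.2.1 p.2.2) 2
      (volume.restrict (Metric.ball 0 R ×ˢ Ioo 0 R ×ˢ Ioo 0 T)) ∧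
    ∀ Ψ : Pos × ℝ × ℝ → Pos,
      MemLp Ψ 2 (volume.restrict (Metric.ball 0 R ×ˢ Ioo 0 R ×ˢ Ioo 0 T)) →
      Tendsto (fun n => ∫ p in Metric.ball 0 R ×ˢ Ioo 0 R ×ˢ Ioo 0 T,
          inner ℝ (Js n p.1 p.2.1 p.2.2) (Ψ p)) atTop
        (𝓝 (∫ p in Metric.ball 0 R ×ˢ Ioo 0 R ×ˢ Ioo 0 T,
          inner ℝ (J p.1 p.2.1 p.2.2) (Ψ p)))

/-- `Eₙ → E` strongly in `L²(0, T; L²_loc(ℝ²))`. -/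
def StrongL2locTendsto (T : ℝ) (Es : ℕ → ℝ → Pos → Pos) (E : ℝ → Pos → Pos) : Prop :=
  MemL2L2loc T E ∧
    ∀ R : ℝ, Tendsto (fun n => eLpNorm (fun q : ℝ × Pos => Es n q.1 q.2 - E q.1 q.2) 2
      (volume.restrict (Ioo 0 T ×ˢ Metric.ball 0 R))) atTop (𝓝 0)

end SHE

end

/-! The proof tests the kinetic equation with functions `ψ(ξ, |v|²/2, t)` of position, kinetic
energy and time. The stiff terms of size `1/α` do not act on them: `v_x ∂_x` vanishes because `x` is
absent, and the magnetic force is orthogonal to `v`, hence does no work. What remains of the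
transport operator is `v_∥ · (∇_ξ + E ∂_ε)ψ` (`inner_lift_sub_crossX`, `fderiv_comp_macroPoint`).

The plates contribute nothing either. Reflection keeps the speed, and the normalization of `K` makes
incoming and outgoing normal flux equal on each energy sphere (`sphere_flux_eq_zero`,
`plate_flux_eq_zero`). Green's formula at almost every time, combined with integration by parts in
time along almost every phase point, gives the weak form on phase space, `phase_weak_form`.

Polar coordinates `v = √(2ε) ω`, with `dv = √(2ε) dε dω`, turn it into the continuity equation.
Integrating `f` over `x` and `ω` yields `4π √(2ε) F`; in the drift term one factor `√(2ε)` from the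
measure and one from `v_∥ = √(2ε) ω_∥` combine to the `2ε` in `J`. No flux appears at `ε = 0`
because `v = 0` is not a boundary of phase space.

In the limit, the density term is linear in `f` and converges weakly-star. The product `J · E` pairs
a weakly convergent sequence with a strongly convergent one, on a bounded box that depends only on
`ψ` (`tendsto_integral_inner_of_weak_of_strong`). This needs each current to be locally square
integrable (`current_memLp`). -/

noncomputable section

namespace SHE

/-! ### Polar coordinates in energy variables -/

/-- The measure `√(2ε) dε` on `(0, ∞)`. -/
def energyMeasure : Measure ℝ :=
  (volume.restrict (Ioi 0)).withDensity fun ε => ENNReal.ofReal √(2 * ε)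

instance : SFinite energyMeasure := by unfold energyMeasure; infer_instance

instance : IsFiniteMeasure surface := by unfold surface; infer_instance

instance : IsFiniteMeasure slabSphere := by unfold slabSphere; infer_instance

instance : SFinite phaseMeasure := by unfold phaseMeasure; infer_instance

theorem measurable_sqrt_density : Measurable fun ε : ℝ => ENNReal.ofReal √(2 * ε) := by
  fun_prop

theorem lintegral_volumeIoiPow (n : ℕ) {g : ℝ → ENNReal} (hg : Measurable g) :
    ∫⁻ r, g r ∂(Measure.volumeIoiPow n) =
      ∫⁻ r in Ioi (0 : ℝ), ENNReal.ofReal (r ^ n) * g r := by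
  rw [Measure.volumeIoiPow, lintegral_withDensity_eq_lintegral_mul _ (by fun_prop) (by fun_prop)]
  exact lintegral_subtype_comap measurableSet_Ioi (fun r => ENNReal.ofReal (r ^ n) * g r)

/-- With `ε = r²/2` one has `dε = r dr` and `√(2ε) = r`, so `√(2ε) dε` is the radial weight `r² dr`.
-/
theorem measurePreserving_halfSq :
    MeasurePreserving (fun r : Ioi (0 : ℝ) => (r : ℝ) ^ 2 / 2) (Measure.volumeIoiPow 2)
      energyMeasure := by
  refine ⟨by fun_prop, Measure.ext_of_lintegral _ fun g hg => ?_⟩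
  rw [lintegral_map hg (by fun_prop), lintegral_volumeIoiPow 2 (g := fun r => g (r ^ 2 / 2))
    (by fun_prop), energyMeasure,
    lintegral_withDensity_eq_lintegral_mul _ (by fun_prop) hg]
  have himg : (fun r : ℝ => r ^ 2 / 2) '' Ioi 0 = Ioi 0 := by
    ext y
    simp only [mem_image, mem_Ioi]
    constructor
    · rintro ⟨r, hr, rfl⟩
      positivity
    · intro hy
      exact ⟨√(2 * y), by positivity, by rw [Real.sq_sqrt (by positivity)]; ring⟩
  have hinj : InjOn (fun r : ℝ => r ^ 2 / 2) (Ioi 0) := by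
    intro a ha b hb hab
    have ha : 0 < a := ha
    have hb : 0 < b := hb
    have : a ^ 2 = b ^ 2 := by simp only at hab; linarith
    exact (sq_eq_sq₀ ha.le hb.le).1 this
  have key := lintegral_image_eq_lintegral_abs_deriv_mul (s := Ioi (0 : ℝ))
    (f := fun r : ℝ => r ^ 2 / 2) (f' := fun r => r) measurableSet_Ioi
    (fun x _ => by
      have := ((hasDerivAt_pow 2 x).div_const 2).hasDerivWithinAt (s := Ioi 0)
      simpa using this) hinj (fun ε => ENNReal.ofReal √(2 * ε) * g ε)
  rw [himg] at key
  simp only [Pi.mul_apply]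
  rw [key]
  refine setLIntegral_congr_fun measurableSet_Ioi fun r hr => ?_
  have hr : 0 < r := hr
  rw [← mul_assoc, ← ENNReal.ofReal_mul (abs_nonneg _), abs_of_pos hr,
    show 2 * (r ^ 2 / 2) = r ^ 2 by ring, Real.sqrt_sq hr.le]
  ring_nf

theorem measurePreserving_unitSphereProd_symm :
    MeasurePreserving (fun p : Dir × Ioi (0 : ℝ) => (p.2 : ℝ) • (p.1 : Vel))
      (surface.prod (Measure.volumeIoiPow 2)) volume := by
  have h := (volume : Measure Vel).measurePreserving_homeomorphUnitSphereProd
  have hfin : Module.finrank ℝ Vel - 1 = 2 := by simp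
  rw [hfin] at h
  -- Polar coordinates only cover the punctured space; the origin is a null set.
  have h2 : MeasurePreserving (Subtype.val : ({0}ᶜ : Set Vel) → Vel)
      ((volume : Measure Vel).comap (↑)) volume := by
    have := measurePreserving_subtype_coe (μa := (volume : Measure Vel)) (s := ({0}ᶜ : Set Vel))
      (measurableSet_singleton _).compl
    rwa [restrict_compl_singleton] at this
  have h3 := MeasurePreserving.symm (homeomorphUnitSphereProd Vel).toMeasurableEquiv h
  exact h2.comp h3

theorem measurePreserving_polar :
    MeasurePreserving (fun p : ℝ × Dir => √(2 * p.1) • (p.2 : Vel))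
      (energyMeasure.prod surface) volume := by
  refine ⟨by fun_prop, ?_⟩
  have h1 : MeasurePreserving (Prod.map (fun r : Ioi (0 : ℝ) => (r : ℝ) ^ 2 / 2) id)
      ((Measure.volumeIoiPow 2).prod surface) (energyMeasure.prod surface) :=
    measurePreserving_halfSq.prod (MeasurePreserving.id surface)
  have h2 := measurePreserving_unitSphereProd_symm.comp
    (Measure.measurePreserving_swap (μ := Measure.volumeIoiPow 2) (ν := surface))
  rw [← h1.map_eq, Measure.map_map (by fun_prop) (by fun_prop), ← h2.map_eq]
  congr 1
  ext1 p
  have : 0 ≤ (p.1 : ℝ) := p.1.2.out.le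
  simp [Real.sqrt_sq this, mul_div_cancel₀]

section Rearrange

variable {A B C : Type*} [MeasurableSpace A] [MeasurableSpace B] [MeasurableSpace C]
  (a : Measure A) (b : Measure B) (c : Measure C) [SFinite a] [SFinite b] [SFinite c]

/-- This and the next rearrangement bring the factors `(x, ω)`, over which `F` and `J` average, into
the inner position for Fubini. -/
theorem measurePreserving_prod_leftComm :
    MeasurePreserving (fun p : A × B × C => (p.2.1, p.1, p.2.2))
      (a.prod (b.prod c)) (b.prod (a.prod c)) :=
  (measurePreserving_prodAssoc b a c).comp
    ((Measure.measurePreserving_swap.prod (MeasurePreserving.id c)).comp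
      (MeasurePreserving.symm MeasurableEquiv.prodAssoc (measurePreserving_prodAssoc a b c)))

theorem measurePreserving_prod_rotate :
    MeasurePreserving (fun p : A × B × C => (p.2.2, p.1, p.2.1))
      (a.prod (b.prod c)) (c.prod (a.prod b)) :=
  Measure.measurePreserving_swap.comp
    (MeasurePreserving.symm MeasurableEquiv.prodAssoc (measurePreserving_prodAssoc a b c))

end Rearrange

/-- The measure `√(2ε) dξ dε` on `ℝ² × (0, ∞)`. -/
def posEnergyMeasure : Measure (Pos × ℝ) := (volume : Measure Pos).prod energyMeasure

instance : SFinite posEnergyMeasure := by unfold posEnergyMeasure; infer_instance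

/-- The measure `√(2ε) dξ dε dt` on `ℝ² × (0, ∞) × (0, T)`. -/
def macroMeasure (T : ℝ) : Measure (Pos × ℝ × ℝ) :=
  (volume : Measure Pos).prod (energyMeasure.prod (volume.restrict (Ioo 0 T)))

instance (T : ℝ) : SFinite (macroMeasure T) := by unfold macroMeasure; infer_instance

/-- The measure `dt dθ` on `(0, T) × Θ`. -/
def timePhaseMeasure (T : ℝ) : Measure (ℝ × Phase) :=
  (volume.restrict (Ioo 0 T)).prod phaseMeasure

instance (T : ℝ) : SFinite (timePhaseMeasure T) := by unfold timePhaseMeasure; infer_instance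

theorem measurePreserving_posPolar :
    MeasurePreserving (fun p : (Pos × ℝ) × Dir => (p.1.1, √(2 * p.1.2) • (p.2 : Vel)))
      (posEnergyMeasure.prod surface) volume :=
  ((MeasurePreserving.id (volume : Measure Pos)).prod measurePreserving_polar).comp
    (measurePreserving_prodAssoc volume energyMeasure surface)

theorem phaseMeasure_eq_prod :
    phaseMeasure = (volume.restrict (Icc (0 : ℝ) 1)).prod (volume : Measure (Pos × Vel)) := by
  rw [phaseMeasure, Measure.volume_eq_prod ℝ (Pos × Vel), ← Measure.prod_restrict,
    Measure.restrict_univ]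

/-- The phase-space point with coordinates `((ξ, ε), (x, ω))`. -/
def phasePolar (p : (Pos × ℝ) × (ℝ × Dir)) : Phase :=
  (p.2.1, p.1.1, √(2 * p.1.2) • (p.2.2 : Vel))

/-- The point of `ℝ × Θ` with coordinates `((ξ, ε, t), (x, ω))`. -/
def timePhasePolar (p : (Pos × ℝ × ℝ) × (ℝ × Dir)) : ℝ × Phase :=
  (p.1.2.2, phasePolar ((p.1.1, p.1.2.1), p.2))

theorem measurePreserving_phasePolar :
    MeasurePreserving phasePolar (posEnergyMeasure.prod slabSphere) phaseMeasure := by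
  rw [phaseMeasure_eq_prod]
  exact ((MeasurePreserving.id _).prod measurePreserving_posPolar).comp
    (measurePreserving_prod_leftComm posEnergyMeasure (volume.restrict (Icc (0 : ℝ) 1)) surface)

theorem measurePreserving_timePhasePolar (T : ℝ) :
    MeasurePreserving timePhasePolar ((macroMeasure T).prod slabSphere)
      (timePhaseMeasure T) := by
  have h1 := (measurePreserving_prod_rotate (volume : Measure Pos) energyMeasure
    (volume.restrict (Ioo 0 T))).prod (MeasurePreserving.id slabSphere)
  have h2 := measurePreserving_prodAssoc (volume.restrict (Ioo 0 T)) posEnergyMeasure slabSphere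
  have h3 := (MeasurePreserving.id (volume.restrict (Ioo 0 T))).prod measurePreserving_phasePolar
  exact h3.comp (h2.comp h1)

theorem posEnergyMeasure_eq_withDensity :
    posEnergyMeasure = (volume.restrict ((univ : Set Pos) ×ˢ Ioi (0 : ℝ))).withDensity
      fun p => ENNReal.ofReal √(2 * p.2) := by
  rw [posEnergyMeasure, energyMeasure, prod_withDensity_right measurable_sqrt_density,
    Measure.volume_eq_prod, ← Measure.prod_restrict, Measure.restrict_univ]

theorem macroMeasure_eq_withDensity (T : ℝ) :
    macroMeasure T =
      (volume.restrict ((univ : Set Pos) ×ˢ Ioi (0 : ℝ) ×ˢ Ioo (0 : ℝ) T)).withDensity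
      fun p => ENNReal.ofReal √(2 * p.2.1) := by
  rw [macroMeasure, energyMeasure, prod_withDensity_left measurable_sqrt_density,
    prod_withDensity_right (g := fun z : ℝ × ℝ => ENNReal.ofReal √(2 * z.1)) (by fun_prop),
    Measure.volume_eq_prod, Measure.volume_eq_prod,
    ← Measure.prod_restrict, ← Measure.prod_restrict, Measure.restrict_univ]

theorem surface_real_univ : surface.real univ = 4 * Real.pi := by
  rw [surface, Measure.toSphere_real_apply_univ, measureReal_def,
    EuclideanSpace.volume_ball_fin_three]
  have : (ENNReal.ofReal (Real.pi * 4 / 3)).toReal = Real.pi * 4 / 3 :=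
    ENNReal.toReal_ofReal (by positivity)
  simp [this]
  ring

theorem slabSphere_real_univ : slabSphere.real univ = 4 * Real.pi := by
  rw [slabSphere, ← univ_prod_univ, measureReal_prod_prod, surface_real_univ]
  simp

theorem norm_sqrt_smul_dir (ε : ℝ) (ω : Dir) : ‖√(2 * ε) • (ω : Vel)‖ = √(2 * ε) := by
  have : ‖(ω : Vel)‖ = 1 := by simp
  rw [norm_smul, this, mul_one, Real.norm_of_nonneg (Real.sqrt_nonneg _)]

theorem norm_sqrt_smul_dir_sq_half {ε : ℝ} (hε : 0 ≤ ε) (ω : Dir) :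
    ‖√(2 * ε) • (ω : Vel)‖ ^ 2 / 2 = ε := by
  rw [norm_sqrt_smul_dir, Real.sq_sqrt (by positivity)]
  ring

/-! ### No net flux through the plates -/

theorem normal_mul_self (i : Fin 2) : normal i * normal i = 1 := by
  unfold normal; split_ifs <;> norm_num

theorem abs_normal (i : Fin 2) : |normal i| = 1 := by
  unfold normal; split_ifs <;> norm_num

theorem Outgoing.abs_eq {i : Fin 2} {v : Vel} (h : Outgoing i v) : |v 0| = normal i * v 0 := by
  rw [← abs_of_pos h, abs_mul, abs_normal, one_mul]

theorem Incoming.abs_eq {i : Fin 2} {v : Vel} (h : Incoming i v) : |v 0| = -(normal i * v 0) := by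
  rw [← abs_of_neg h, abs_mul, abs_normal, one_mul]

theorem measurableSet_outgoing (i : Fin 2) : MeasurableSet {ω : Dir | Outgoing i ω} :=
  measurableSet_lt (by fun_prop) (by fun_prop)

theorem measurableSet_incoming (i : Fin 2) : MeasurableSet {ω : Dir | Incoming i ω} :=
  measurableSet_lt (by fun_prop) (by fun_prop)

/-- A reflection law on the sphere that conserves the normal flux produces no net flux. -/
theorem sphere_flux_eq_zero (i : Fin 2) {k : Dir × Dir → ℝ} (hk : Measurable k)
    (hnn : ∀ᵐ q : Dir × Dir ∂(surface.prod surface),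
      Outgoing i q.1 → Incoming i q.2 → 0 ≤ k q)
    (hflux : ∀ᵐ ω' : Dir ∂surface, Outgoing i ω' →
      ∫ ω in {ω : Dir | Incoming i ω}, k (ω', ω) * |(ω : Vel) 0| ∂surface = 1)
    {w : Dir → ℝ} (hw : Integrable (fun ω : Dir => (ω : Vel) 0 * w ω) surface)
    (hbc : ∀ᵐ ω : Dir ∂surface, Incoming i ω →
      w ω = ∫ ω' in {ω' : Dir | Outgoing i ω'}, k (ω', ω) * w ω' * |(ω' : Vel) 0| ∂surface) :
    ∫ ω : Dir, (ω : Vel) 0 * w ω ∂surface = 0 := by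
  set O : Set Dir := {ω : Dir | Outgoing i ω} with hO
  set N : Set Dir := {ω : Dir | Incoming i ω} with hN
  have mO : MeasurableSet O := measurableSet_outgoing i
  have mN : MeasurableSet N := measurableSet_incoming i
  have hwO : IntegrableOn (fun ω : Dir => w ω * |(ω : Vel) 0|) O surface := by
    refine ((hw.const_mul (normal i)).integrableOn (s := O)).congr_fun (fun ω hω => ?_) mO
    have := Outgoing.abs_eq hω
    simp only [this]
    ring
  have hnn' : ∀ᵐ ω' ∂(surface.restrict O), ∀ᵐ ω ∂(surface.restrict N), 0 ≤ k (ω', ω) := by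
    have h := Measure.ae_ae_of_ae_prod hnn
    rw [ae_restrict_iff' mO]
    filter_upwards [h] with ω' h' hω'
    rw [ae_restrict_iff' mN]
    filter_upwards [h'] with ω h'' hω using h'' hω' hω
  have hflux' : ∀ᵐ ω' ∂(surface.restrict O),
      ∫ ω in N, k (ω', ω) * |(ω : Vel) 0| ∂surface = 1 := by
    rwa [ae_restrict_iff' mO]
  let H : Dir × Dir → ℝ := fun q => (k q * |(q.2 : Vel) 0|) * (w q.1 * |(q.1 : Vel) 0|)
  have hHm : AEStronglyMeasurable H ((surface.restrict O).prod (surface.restrict N)) := by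
    refine AEStronglyMeasurable.mul (Measurable.aestronglyMeasurable (by fun_prop)) ?_
    exact hwO.aestronglyMeasurable.comp_fst
  -- Absolute integrability for Fubini: nonnegativity and the flux normalization collapse the inner
  -- integral of `|H|` to `|w ω'| |ω'_x|`.
  have hHi : Integrable H ((surface.restrict O).prod (surface.restrict N)) := by
    rw [integrable_prod_iff hHm]
    constructor
    · filter_upwards [hflux'] with ω' h1
      suffices Integrable (fun ω : Dir => k (ω', ω) * |(ω : Vel) 0|) (surface.restrict N) from
        this.mul_const (w ω' * |(ω' : Vel) 0|)
      -- A non-integrable function has Bochner integral `0`, which contradicts the value `1`.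
      by_contra hcon
      rw [integral_undef hcon] at h1
      exact zero_ne_one h1
    · refine hwO.norm.congr ?_
      filter_upwards [hflux', hnn'] with ω' h1 h2
      have : ∫ ω, ‖H (ω', ω)‖ ∂(surface.restrict N) =
          ∫ ω, (k (ω', ω) * |(ω : Vel) 0|) * ‖w ω' * |(ω' : Vel) 0|‖ ∂(surface.restrict N) := by
        refine integral_congr_ae ?_
        filter_upwards [h2] with ω h3
        simp only [H, norm_mul, Real.norm_eq_abs, abs_abs, abs_of_nonneg h3]
      rw [this, integral_mul_const, h1, one_mul]
  -- The boundary condition expresses the incoming flux through outgoing values; after swapping the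
  -- integrals, the kernel integrates to `1`.
  have hin : ∫ ω in N, (ω : Vel) 0 * w ω ∂surface =
      -(normal i * ∫ ω in O, w ω * |(ω : Vel) 0| ∂surface) := by
    have h1 : ∫ ω in N, (ω : Vel) 0 * w ω ∂surface =
        ∫ ω in N, -normal i * ∫ ω' in O, H (ω', ω) ∂surface ∂surface := by
      refine setIntegral_congr_ae mN ?_
      filter_upwards [hbc] with ω h hω
      have h2 : ∫ ω' in O, H (ω', ω) ∂surface = |(ω : Vel) 0| * w ω := by
        rw [h hω, ← integral_const_mul]
        refine integral_congr_ae (Eventually.of_forall fun ω' => ?_)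
        simp only [H]
        ring
      rw [h2, Incoming.abs_eq hω]
      linear_combination (-(ω : Vel) 0 * w ω) * normal_mul_self i
    have h2 : ∫ ω in N, ∫ ω' in O, H (ω', ω) ∂surface ∂surface =
        ∫ ω in O, w ω * |(ω : Vel) 0| ∂surface := by
      rw [← integral_integral_swap (f := fun ω' ω => H (ω', ω)) hHi]
      refine integral_congr_ae ?_
      filter_upwards [hflux'] with ω' h1
      simp only [H]
      rw [integral_mul_const, h1, one_mul]
    rw [h1, integral_const_mul, h2]
    ring
  have hout : ∫ ω in O, (ω : Vel) 0 * w ω ∂surface =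
      normal i * ∫ ω in O, w ω * |(ω : Vel) 0| ∂surface := by
    rw [← integral_const_mul]
    refine setIntegral_congr_fun mO fun ω hω => ?_
    simp only [Outgoing.abs_eq hω]
    linear_combination (-(ω : Vel) 0 * w ω) * normal_mul_self i
  -- The grazing directions, neither incoming nor outgoing, have `ω_x = 0` and carry no flux.
  have hcompl : ∫ ω in Oᶜ, (ω : Vel) 0 * w ω ∂surface =
      ∫ ω in N, (ω : Vel) 0 * w ω ∂surface := by
    refine setIntegral_eq_of_subset_of_forall_sdiff_eq_zero mO.compl
      (fun ω hω hω' => lt_asymm (show normal i * (ω : Vel) 0 < 0 from hω)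
        (show 0 < normal i * (ω : Vel) 0 from hω')) fun ω hω => ?_
    have h1 : ¬ 0 < normal i * (ω : Vel) 0 := hω.1
    have h2 : ¬ normal i * (ω : Vel) 0 < 0 := hω.2
    have h3 : normal i * (ω : Vel) 0 = 0 := le_antisymm (not_lt.1 h1) (not_lt.1 h2)
    have h4 : (ω : Vel) 0 = 0 := by
      linear_combination normal i * h3 - (ω : Vel) 0 * normal_mul_self i
    rw [h4, zero_mul]
  rw [← integral_add_compl mO hw, hcompl, hin, hout, add_neg_cancel]

/-- A trace that satisfies the reflection condition has no flux through the plate against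
functions of position and energy. -/
theorem plate_flux_eq_zero {K : Pos → ℝ → Vel → Vel → ℝ} (hK : IsReflectionKernel K) (i : Fin 2)
    {u : Pos × Vel → ℝ}
    (hbc : ∀ᵐ q : Pos × Vel, Incoming i q.2 →
      u q = boundaryOp K i q.1 (fun v => u (q.1, v)) q.2)
    (η : Pos → ℝ → ℝ)
    (hint : Integrable fun q : Pos × Vel => q.2 0 * u q * η q.1 (‖q.2‖ ^ 2 / 2)) :
    ∫ q : Pos × Vel, q.2 0 * u q * η q.1 (‖q.2‖ ^ 2 / 2) = 0 := by
  have hP := measurePreserving_posPolar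
  have hint' := hP.integrable_comp_of_integrable hint
  simp only [Function.comp_def] at hint'
  have hpos : ∀ᵐ p ∂posEnergyMeasure, 0 < p.2 := by
    rw [posEnergyMeasure_eq_withDensity]
    refine (withDensity_absolutelyContinuous _ _).ae_le ?_
    filter_upwards [ae_restrict_mem (MeasurableSet.univ.prod measurableSet_Ioi)] with p hp
      using hp.2
  have hbc' := Measure.ae_ae_of_ae_prod (hP.quasiMeasurePreserving.ae hbc)
  rw [← hP.map_eq, integral_map hP.aemeasurable (by rw [hP.map_eq]; exact hint.1),
    integral_prod _ hint']
  refine integral_eq_zero_of_ae ?_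
  filter_upwards [hpos, hbc', hint'.prod_right_ae] with p hp hb hi
  obtain ⟨ξ, ε⟩ := p
  have hp : 0 < ε := hp
  have hr : 0 < √(2 * ε) := by positivity
  have hsq : √(2 * ε) ^ 2 / 2 = ε := by
    rw [Real.sq_sqrt (by positivity)]
    ring
  simp only [hsq, PiLp.smul_apply, smul_eq_mul,
    norm_sqrt_smul_dir, boundaryOp, smul_smul, inv_mul_cancel₀ hr.ne', one_smul, Pi.zero_apply]
    at hb hi ⊢
  -- If the test function vanishes on this energy sphere there is nothing to prove; otherwise
  -- dividing by it gives the integrability of `ω_x u` required on the sphere.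
  by_cases hη : η ξ ε = 0
  · simp [hη]
  have hscale : ∀ ω : Dir, √(2 * ε) * (ω : Vel) 0 * u (ξ, √(2 * ε) • (ω : Vel)) * η ξ ε =
      (√(2 * ε) * η ξ ε) * ((ω : Vel) 0 * u (ξ, √(2 * ε) • (ω : Vel))) := fun ω => by ring
  simp only [hscale] at hi ⊢
  have hw := (integrable_const_mul_iff
    (IsUnit.mk0 (√(2 * ε) * η ξ ε) (mul_ne_zero hr.ne' hη)) _).1 hi
  rw [integral_const_mul, sphere_flux_eq_zero i (k := fun q => K ξ ε q.1 q.2) ?_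
    (hK.nonneg ξ ε hp i) (hK.flux ξ ε hp i) hw, mul_zero]
  · filter_upwards [hb] with ω h hω
    refine h ?_
    have : normal i * (√(2 * ε) * (ω : Vel) 0) = √(2 * ε) * (normal i * (ω : Vel) 0) := by ring
    simp only [Incoming, PiLp.smul_apply, smul_eq_mul, this]
    exact mul_neg_of_pos_of_neg hr hω
  · exact hK.measurable.comp (by fun_prop :
      Measurable fun q : Dir × Dir => (ξ, ε, (q.1 : Vel), (q.2 : Vel)))

/-! ### Test functions on phase space -/

/-- The point `(ξ, |v|²/2, t)` seen by a phase-space point at time `t`. -/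
def macroPoint (t : ℝ) (p : Phase) : Pos × ℝ × ℝ := (p.2.1, ‖p.2.2‖ ^ 2 / 2, t)

/-- The direction `(v_∥, v_∥ · E, 0)` in which the transport operator differentiates functions of
position and energy. -/
def macroDir (E : Pos → Pos) (p : Phase) : Pos × ℝ × ℝ :=
  (par p.2.2, inner ℝ (par p.2.2) (E p.2.1), 0)

theorem IsTest.exists_bounds {T : ℝ} {ψ : Pos × ℝ × ℝ → ℝ} (hψ : IsTest T ψ) :
    ∃ R M : ℝ, 0 < R ∧ 0 ≤ M ∧ (∀ p, |ψ p| ≤ M) ∧ (∀ p, ‖fderiv ℝ ψ p‖ ≤ M) ∧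
      (∀ p, R ≤ ‖p‖ → ψ p = 0) ∧ ∀ p, R ≤ ‖p‖ → fderiv ℝ ψ p = 0 := by
  obtain ⟨M₁, h₁⟩ := hψ.compact.exists_bound_of_continuous hψ.contDiff.continuous
  have hc : Continuous (fderiv ℝ ψ) := hψ.contDiff.continuous_fderiv (by norm_num)
  obtain ⟨M₂, h₂⟩ := (hψ.compact.fderiv (𝕜 := ℝ)).exists_bound_of_continuous hc
  obtain ⟨R, hR⟩ := (hψ.compact.isBounded).subset_ball (0 : Pos × ℝ × ℝ)
  -- The maximum with `1` makes the radius positive.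
  have hout : ∀ p, max R 1 ≤ ‖p‖ → p ∉ tsupport ψ := fun p hp hmem => by
    have := hR hmem
    rw [mem_ball_zero_iff] at this
    exact absurd ((le_max_left R 1).trans hp) (not_le.2 this)
  refine ⟨max R 1, max M₁ M₂, by positivity, ?_, fun p => (h₁ p).trans (le_max_left _ _),
    fun p => (h₂ p).trans (le_max_right _ _), fun p hp => image_eq_zero_of_notMem_tsupport
    (hout p hp), fun p hp => ?_⟩
  · exact (norm_nonneg _).trans ((h₁ 0).trans (le_max_left _ _))
  · by_contra hne
    exact hout p hp (support_fderiv_subset ℝ (f := ψ) hne)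

/-- A large velocity means a large energy, since `(R + 2)²/2 ≥ R`. Hence a support bound in `(ξ, ε,
t)` becomes one in `(ξ, v)` with radius `R + 2`. -/
theorem le_norm_macroPoint {R : ℝ} (hR : 0 < R) (t : ℝ) (p : Phase)
    (h : R + 2 ≤ ‖p.2.1‖ ∨ R + 2 ≤ ‖p.2.2‖) : R ≤ ‖macroPoint t p‖ := by
  rcases h with h | h
  · exact (by linarith : R ≤ ‖p.2.1‖).trans (norm_fst_le (macroPoint t p))
  · have h1 : R ≤ ‖p.2.2‖ ^ 2 / 2 := by nlinarith
    refine h1.trans ((le_abs_self _).trans ?_)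
    exact (norm_fst_le (macroPoint t p).2).trans (norm_snd_le (macroPoint t p))

theorem contDiff_macroPoint (t : ℝ) {n : WithTop ℕ∞} : ContDiff ℝ n (macroPoint t) :=
  (contDiff_fst.comp contDiff_snd).prodMk
    ((((contDiff_snd.comp contDiff_snd).norm_sq ℝ).div_const 2).prodMk contDiff_const)

theorem continuous_macroPoint : Continuous fun q : ℝ × Phase => macroPoint q.1 q.2 := by
  unfold macroPoint
  fun_prop

theorem continuous_par : Continuous par := by
  unfold par
  fun_prop

/-- The magnetic force does no work, and the electric force acts only parallel to the plates. -/
theorem inner_lift_sub_crossX (v : Vel) (e : Pos) (c : ℝ) :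
    inner ℝ v (lift e - c • crossX v) = inner ℝ (par v) e := by
  simp [PiLp.inner_apply, Fin.sum_univ_three, Fin.sum_univ_two, lift, crossX, par]
  ring

/-- The chain rule; the `x`-component of `w` drops out, and with it the term `α⁻¹ v_x ∂_x`. -/
theorem fderiv_comp_macroPoint {ψ : Pos × ℝ × ℝ → ℝ} (hψ : Differentiable ℝ ψ) (t : ℝ)
    (p w : Phase) :
    fderiv ℝ (fun p => ψ (macroPoint t p)) p w =
      fderiv ℝ ψ (macroPoint t p) (w.2.1, inner ℝ p.2.2 w.2.2, 0) := by
  have h1 : HasFDerivAt (fun p : Phase => p.2.1)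
      ((ContinuousLinearMap.fst ℝ Pos Vel).comp (ContinuousLinearMap.snd ℝ ℝ (Pos × Vel))) p :=
    hasFDerivAt_fst.comp p hasFDerivAt_snd
  have h2 : HasFDerivAt (fun p : Phase => p.2.2)
      ((ContinuousLinearMap.snd ℝ Pos Vel).comp (ContinuousLinearMap.snd ℝ ℝ (Pos × Vel))) p :=
    hasFDerivAt_snd.comp p hasFDerivAt_snd
  have h3 := (h2.norm_sq).mul_const (2⁻¹ : ℝ)
  have h4 := h1.prodMk (h3.prodMk (hasFDerivAt_const t p))
  have h5 := (hψ (macroPoint t p)).hasFDerivAt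
  have hfun : macroPoint t = fun p : Phase => (p.2.1, ‖p.2.2‖ ^ 2 * 2⁻¹, t) := by
    funext p
    rw [macroPoint, div_eq_mul_inv]
  have h6 := h5.comp p (f := macroPoint t) (by rw [hfun]; exact h4)
  have h7 := congrArg (fun L => L w) h6.fderiv
  simp only [Function.comp_def] at h7
  rw [h7]
  simp

/-- A smooth cutoff that equals `1` on `[-2, 2]`. -/
def slabBump : ContDiffBump (0 : ℝ) := ⟨2, 3, by norm_num, by norm_num⟩

theorem slabBump_eventuallyEq_one {x : ℝ} (hx : x ∈ Icc (0 : ℝ) 1) :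
    (slabBump : ℝ → ℝ) =ᶠ[𝓝 x] 1 := by
  refine slabBump.eventuallyEq_one_of_mem_ball ?_
  rw [mem_ball_zero_iff, Real.norm_eq_abs, abs_of_nonneg hx.1]
  exact lt_of_le_of_lt hx.2 (by norm_num [slabBump])

theorem slabBump_plate (i : Fin 2) : slabBump (plate i) = 1 := by
  refine (slabBump_eventuallyEq_one ?_).eq_of_nhds
  unfold plate
  split_ifs <;> simp

theorem ae_phaseMeasure_mem : ∀ᵐ p ∂phaseMeasure, p.1 ∈ Icc (0 : ℝ) 1 := by
  rw [phaseMeasure]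
  filter_upwards [ae_restrict_mem (measurableSet_Icc.prod MeasurableSet.univ)] with p hp
    using hp.1

/-- The flux density at a plate against a test function is integrable. -/
theorem integrable_plate_flux {T : ℝ} {ψ : Pos × ℝ × ℝ → ℝ} (hψ : IsTest T ψ) (t : ℝ)
    {u : Pos × Vel → ℝ} (hu : AEStronglyMeasurable u)
    (hsq : ∀ n : ℕ, ∫⁻ q in {q : Pos × Vel | ‖q.2‖ ≤ n},
      ENNReal.ofReal (|q.2 0| * u q ^ 2) < ⊤) :
    Integrable fun q : Pos × Vel => q.2 0 * u q * ψ (q.1, ‖q.2‖ ^ 2 / 2, t) := by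
  obtain ⟨R, M, hR, hM, hb, -, hz, -⟩ := hψ.exists_bounds
  obtain ⟨n, hn⟩ := exists_nat_ge (R + 2)
  set S : Set (Pos × Vel) := Metric.closedBall 0 (R + 2) ×ˢ Metric.closedBall 0 (R + 2) with hS
  have mS : MeasurableSet S := measurableSet_closedBall.prod measurableSet_closedBall
  have hSfin : volume S < ⊤ := by
    exact ((isCompact_closedBall _ _).prod (isCompact_closedBall _ _)).measure_lt_top
  have hvx : Continuous fun q : Pos × Vel => q.2 0 := by fun_prop
  have hψc : Continuous fun q : Pos × Vel => ψ (q.1, ‖q.2‖ ^ 2 / 2, t) :=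
    hψ.contDiff.continuous.comp (by fun_prop)
  have hsupp : Function.support (fun q : Pos × Vel => q.2 0 * u q * ψ (q.1, ‖q.2‖ ^ 2 / 2, t))
      ⊆ S := by
    intro q hq
    by_contra hqS
    refine hq ?_
    have : R ≤ ‖macroPoint t (0, q)‖ := by
      refine le_norm_macroPoint hR t (0, q) ?_
      by_contra hcon
      push Not at hcon
      exact hqS ⟨by simpa using hcon.1.le, by simpa using hcon.2.le⟩
    simp only [show ψ (q.1, ‖q.2‖ ^ 2 / 2, t) = 0 from hz _ this, mul_zero]
  rw [← integrableOn_iff_integrable_of_support_subset hsupp]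
  have h1 : IntegrableOn (fun q : Pos × Vel => |q.2 0| * u q ^ 2) S := by
    have h2 : IntegrableOn (fun q : Pos × Vel => |q.2 0| * u q ^ 2)
        {q : Pos × Vel | ‖q.2‖ ≤ n} := by
      refine ⟨((hvx.abs.aestronglyMeasurable).mul (hu.pow 2)).restrict, ?_⟩
      rw [hasFiniteIntegral_iff_ofReal (Eventually.of_forall fun q => by positivity)]
      exact hsq n
    refine h2.mono_set fun q hq => ?_
    exact (by simpa using hq.2 : ‖q.2‖ ≤ R + 2).trans hn
  have h3 : IntegrableOn (fun q : Pos × Vel => |q.2 0|) S := by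
    refine hvx.abs.continuousOn.integrableOn_compact ?_
    exact (isCompact_closedBall _ _).prod (isCompact_closedBall _ _)
  refine ((h1.add h3).const_mul M).mono'
    (((hvx.aestronglyMeasurable.mul hu).mul hψc.aestronglyMeasurable).restrict)
    (Eventually.of_forall fun q => ?_)
  simp only [norm_mul, Real.norm_eq_abs, Pi.add_apply]
  -- The trace is only square integrable against `|v_x|`; on the bounded support the weight `|v_x|`
  -- is itself integrable, which absorbs the `1`.
  have h4 : |u q| ≤ u q ^ 2 + 1 := by nlinarith [sq_abs (u q), sq_nonneg (|u q| - 1)]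
  calc |q.2 0| * |u q| * |ψ (q.1, ‖q.2‖ ^ 2 / 2, t)|
      ≤ |q.2 0| * (u q ^ 2 + 1) * M := by gcongr; exact hb _
    _ = M * (|q.2 0| * u q ^ 2 + |q.2 0|) := by ring

/-- Green's formula against a function of position and energy, at a fixed time: the plates do not
contribute. -/
theorem green_slice {T α : ℝ} {K : Pos → ℝ → Vel → Vel → ℝ} (hK : IsReflectionKernel K)
    {ψ : Pos × ℝ × ℝ → ℝ} (hψ : IsTest T ψ) (t : ℝ) {E : Pos → Pos} {B : Pos → ℝ}
    {f h : Phase → ℝ} {g : Fin 2 → Pos × Vel → ℝ} (hg : HasTransportAndTrace α E B f h g)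
    (hgm : ∀ i, AEStronglyMeasurable (g i))
    (hsq : ∀ i, ∀ n : ℕ, ∫⁻ q in {q : Pos × Vel | ‖q.2‖ ≤ n},
      ENNReal.ofReal (|q.2 0| * g i q ^ 2) < ⊤)
    (hbc : ∀ i, ∀ᵐ q : Pos × Vel, Incoming i q.2 →
      g i q = boundaryOp K i q.1 (fun v => g i (q.1, v)) q.2) :
    (∫ p, h p * ψ (macroPoint t p) ∂phaseMeasure) +
      ∫ p, f p * fderiv ℝ ψ (macroPoint t p) (macroDir E p) ∂phaseMeasure = 0 := by
  obtain ⟨R, M, hR, -, -, -, hz, -⟩ := hψ.exists_bounds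
  have hψ1 : ContDiff ℝ 1 ψ := hψ.contDiff.of_le (by norm_num)
  -- Green's formula requires compact support in all of `ℝ × ℝ² × ℝ³`, so the test function is cut
  -- off in `x`. The cutoff is `1` near the slab and changes neither values nor derivatives there.
  let Ψ : Phase → ℝ := fun p => slabBump p.1 * ψ (macroPoint t p)
  have hΨ : ContDiff ℝ 1 Ψ := by
    refine ContDiff.mul (slabBump.contDiff.comp contDiff_fst) (hψ1.comp (contDiff_macroPoint t))
  have hΨc : HasCompactSupport Ψ := by
    refine HasCompactSupport.intro' (K := Metric.closedBall (0 : ℝ) 3 ×ˢ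
      (Metric.closedBall (0 : Pos) (R + 2) ×ˢ Metric.closedBall (0 : Vel) (R + 2)))
      ((isCompact_closedBall _ _).prod ((isCompact_closedBall _ _).prod
        (isCompact_closedBall _ _)))
      (Metric.isClosed_closedBall.prod (Metric.isClosed_closedBall.prod
        Metric.isClosed_closedBall)) fun p hp => ?_
    by_cases hx : p.1 ∈ Metric.closedBall (0 : ℝ) 3
    · have : R ≤ ‖macroPoint t p‖ := by
        refine le_norm_macroPoint hR t p ?_
        by_contra hcon
        push Not at hcon
        exact hp ⟨hx, by simpa using hcon.1.le, by simpa using hcon.2.le⟩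
      simp only [Ψ, hz _ this, mul_zero]
    · have : slabBump p.1 = 0 := by
        refine slabBump.zero_of_le_dist ?_
        rw [Metric.mem_closedBall, not_le] at hx
        exact hx.le
      simp only [Ψ, this, zero_mul]
  have key := hg Ψ hΨ hΨc
  have hzero : ∀ i, ∫ q : Pos × Vel, q.2 0 * g i q * Ψ (plate i, q) = 0 := by
    intro i
    have h1 : ∀ q : Pos × Vel, Ψ (plate i, q) = ψ (q.1, ‖q.2‖ ^ 2 / 2, t) := fun q => by
      simp only [Ψ, slabBump_plate, one_mul, macroPoint]
    simp only [h1]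
    exact plate_flux_eq_zero hK i (hbc i) (fun ξ ε => ψ (ξ, ε, t))
      (integrable_plate_flux hψ t (hgm i) (hsq i))
  simp only [hzero, mul_zero, Finset.sum_const_zero] at key
  rw [← key]
  congr 1
  · refine integral_congr_ae ?_
    filter_upwards [ae_phaseMeasure_mem] with p hp
    simp only [Ψ, (slabBump_eventuallyEq_one hp).eq_of_nhds, Pi.one_apply, one_mul]
  · refine integral_congr_ae ?_
    filter_upwards [ae_phaseMeasure_mem] with p hp
    have h1 : Ψ =ᶠ[𝓝 p] fun p => ψ (macroPoint t p) := by
      have := (continuous_fst.tendsto p).eventually (slabBump_eventuallyEq_one hp)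
      filter_upwards [this] with p' hp'
      simp only [Ψ, hp', Pi.one_apply, one_mul]
    rw [transport, h1.fderiv_eq, fderiv_comp_macroPoint (hψ1.differentiable (by norm_num))]
    simp only [transportField, inner_lift_sub_crossX, macroDir]

/-! ### Integrability on the time-phase space -/

/-- The part of phase space with `|ξ|, |v| ≤ R`. -/
def testRegion (R : ℝ) : Set Phase :=
  univ ×ˢ Metric.closedBall (0 : Pos) R ×ˢ Metric.closedBall (0 : Vel) R

theorem measurableSet_testRegion (R : ℝ) : MeasurableSet (testRegion R) :=
  MeasurableSet.univ.prod (measurableSet_closedBall.prod measurableSet_closedBall)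

theorem phaseMeasure_restrict_testRegion (R : ℝ) :
    phaseMeasure.restrict (testRegion R) = (volume.restrict (Icc (0 : ℝ) 1)).prod
      ((volume.restrict (Metric.closedBall (0 : Pos) R)).prod
        (volume.restrict (Metric.closedBall (0 : Vel) R))) := by
  rw [phaseMeasure_eq_prod, testRegion, ← Measure.prod_restrict, Measure.restrict_univ,
    Measure.volume_eq_prod Pos Vel, ← Measure.prod_restrict]

instance (R : ℝ) : IsFiniteMeasure ((volume : Measure Pos).restrict (Metric.closedBall 0 R)) :=
  ⟨by rw [Measure.restrict_apply_univ]; exact measure_closedBall_lt_top⟩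

instance (R : ℝ) : IsFiniteMeasure ((volume : Measure Vel).restrict (Metric.closedBall 0 R)) :=
  ⟨by rw [Measure.restrict_apply_univ]; exact measure_closedBall_lt_top⟩

theorem phaseMeasure_testRegion_lt_top (R : ℝ) : phaseMeasure (testRegion R) < ⊤ := by
  rw [← Measure.restrict_apply_univ, phaseMeasure_restrict_testRegion]
  exact measure_lt_top _ _

theorem timePhaseMeasure_restrict_testRegion (T R : ℝ) :
    (timePhaseMeasure T).restrict (univ ×ˢ testRegion R) =
      (volume.restrict (Ioo 0 T)).prod (phaseMeasure.restrict (testRegion R)) := by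
  rw [timePhaseMeasure, ← Measure.prod_restrict, Measure.restrict_univ]

instance (T R : ℝ) : IsFiniteMeasure ((timePhaseMeasure T).restrict (univ ×ˢ testRegion R)) := by
  rw [timePhaseMeasure_restrict_testRegion, phaseMeasure_restrict_testRegion]
  infer_instance

theorem eq_zero_of_notMem_testRegion {X : Type*} [Zero X] {φ : Pos × ℝ × ℝ → X} {R : ℝ}
    (hR : 0 < R) (hz : ∀ p, R ≤ ‖p‖ → φ p = 0) (t : ℝ) {p : Phase} (hp : p ∉ testRegion (R + 2)) :
    φ (macroPoint t p) = 0 := by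
  refine hz _ (le_norm_macroPoint hR t p ?_)
  by_contra hcon
  push Not at hcon
  exact hp ⟨mem_univ _, by simpa using hcon.1.le, by simpa using hcon.2.le⟩

theorem norm_le_indicator_testRegion {φ : Pos × ℝ × ℝ → ℝ} {R M : ℝ} (hR : 0 < R)
    (hb : ∀ p, |φ p| ≤ M) (hz : ∀ p, R ≤ ‖p‖ → φ p = 0) (t : ℝ) (p : Phase) :
    ‖φ (macroPoint t p)‖ ≤ ‖(testRegion (R + 2)).indicator (fun _ => M) p‖ := by
  by_cases hp : p ∈ testRegion (R + 2)
  · rw [indicator_of_mem hp]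
    exact (hb _).trans (le_abs_self M)
  · rw [eq_zero_of_notMem_testRegion hR hz t hp, norm_zero]
    exact norm_nonneg _

/-- The bound is uniform in `t`, so over the bounded interval `(0, T)` it places the test function
in `L¹(0, T; L²(Θ))`, as weak-star convergence demands. -/
theorem eLpNorm_macroPoint_le {φ : Pos × ℝ × ℝ → ℝ} {R M : ℝ} (hR : 0 < R)
    (hb : ∀ p, |φ p| ≤ M) (hz : ∀ p, R ≤ ‖p‖ → φ p = 0) (t : ℝ) :
    eLpNorm (fun p => φ (macroPoint t p)) 2 phaseMeasure ≤
      eLpNorm ((testRegion (R + 2)).indicator fun _ => M) 2 phaseMeasure :=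
  eLpNorm_mono (norm_le_indicator_testRegion hR hb hz t)

theorem memLp_indicator_testRegion (R M : ℝ) :
    MemLp ((testRegion R).indicator fun _ => M) 2 phaseMeasure :=
  memLp_indicator_const 2 (measurableSet_testRegion R) M
    (Or.inr (phaseMeasure_testRegion_lt_top R).ne)

theorem memLp_macroPoint_slice {φ : Pos × ℝ × ℝ → ℝ} (hφ : Continuous φ) {R M : ℝ} (hR : 0 < R)
    (hb : ∀ p, |φ p| ≤ M) (hz : ∀ p, R ≤ ‖p‖ → φ p = 0) (t : ℝ) :
    MemLp (fun p => φ (macroPoint t p)) 2 phaseMeasure :=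
  (memLp_indicator_testRegion (R + 2) M).mono
    (hφ.comp (contDiff_macroPoint t (n := 0)).continuous).aestronglyMeasurable
    (Eventually.of_forall (norm_le_indicator_testRegion hR hb hz t))

theorem memLp_macroPoint {φ : Pos × ℝ × ℝ → ℝ} (hφ : Continuous φ) {R M : ℝ} (hR : 0 < R)
    (hb : ∀ p, |φ p| ≤ M) (hz : ∀ p, R ≤ ‖p‖ → φ p = 0) (T : ℝ) :
    MemLp (fun q : ℝ × Phase => φ (macroPoint q.1 q.2)) 2 (timePhaseMeasure T) := by
  have : IsFiniteMeasure (volume.restrict (Ioo 0 T)) := ⟨by simp⟩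
  exact ((memLp_indicator_testRegion (R + 2) M).comp_snd (volume.restrict (Ioo 0 T))).mono
    (hφ.comp continuous_macroPoint).aestronglyMeasurable
    (Eventually.of_forall fun q => norm_le_indicator_testRegion hR hb hz q.1 q.2)

/-- The interval `(0, T)` is bounded, so Tonelli applied to the square suffices. Pairings with test
functions thereby become products of two `L²` functions. -/
theorem MemLinftyL2.memLp {T : ℝ} {f : ℝ → Phase → ℝ} (hf : MemLinftyL2 T f) :
    MemLp (fun q : ℝ × Phase => f q.1 q.2) 2 (timePhaseMeasure T) := by
  obtain ⟨hm, c, hc⟩ := hf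
  refine ⟨hm, ?_⟩
  have h2 : ((2 : NNReal) : ENNReal) = 2 := rfl
  rw [← ENNReal.pow_lt_top_iff (n := 2) |>.trans (or_iff_left (by norm_num))]
  have h3 := eLpNorm_nnreal_pow_eq_lintegral (f := fun q : ℝ × Phase => f q.1 q.2)
    (μ := timePhaseMeasure T) (p := 2) (by norm_num)
  simp only [h2, NNReal.coe_ofNat, ENNReal.rpow_ofNat] at h3
  rw [h3, timePhaseMeasure, lintegral_prod _ (hm.enorm.pow_const 2)]
  calc ∫⁻ t in Ioo 0 T, ∫⁻ p, ‖f t p‖ₑ ^ 2 ∂phaseMeasure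
      ≤ ∫⁻ _ in Ioo 0 T, (c : ENNReal) ^ 2 := by
        refine lintegral_mono_ae ?_
        filter_upwards [hc] with t ht
        have h4 := eLpNorm_nnreal_pow_eq_lintegral (f := f t)
          (μ := phaseMeasure) (p := 2) (by norm_num)
        simp only [h2, NNReal.coe_ofNat, ENNReal.rpow_ofNat] at h4
        rw [← h4]
        gcongr
    _ < ⊤ := by
        rw [setLIntegral_const, Real.volume_Ioo]
        exact ENNReal.mul_lt_top (by simp) ENNReal.ofReal_lt_top

theorem norm_par_le (v : Vel) : ‖par v‖ ≤ ‖v‖ := by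
  rw [EuclideanSpace.norm_eq, EuclideanSpace.norm_eq]
  refine Real.sqrt_le_sqrt ?_
  simp [Fin.sum_univ_three, Fin.sum_univ_two, par]
  nlinarith [sq_nonneg (v 0)]

theorem measurePreserving_timePhase_regroup {a : Measure ℝ} {b : Measure ℝ} {c : Measure Pos}
    {d : Measure Vel} [SFinite a] [SFinite b] [SFinite c] [SFinite d] :
    MeasurePreserving (fun q : ℝ × Phase => ((q.1, q.2.2.1), (q.2.1, q.2.2.2)))
      (a.prod (b.prod (c.prod d))) ((a.prod c).prod (b.prod d)) :=
  (MeasurePreserving.symm MeasurableEquiv.prodAssoc (measurePreserving_prodAssoc a c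
    (b.prod d))).comp ((MeasurePreserving.id a).prod (measurePreserving_prod_leftComm b c d))

theorem MemL2L2loc.memLp_phase {T : ℝ} {E : ℝ → Pos → Pos} (hE : MemL2L2loc T E) (R : ℝ) :
    MemLp (fun q : ℝ × Phase => E q.1 q.2.2.1) 2
      ((timePhaseMeasure T).restrict (univ ×ˢ testRegion R)) := by
  -- The field is controlled on open balls, while the test region is made of closed ones.
  have h1 := hE (R + 1)
  have h2 : MemLp (fun q : ℝ × Pos => E q.1 q.2) 2
      ((volume.restrict (Ioo 0 T)).prod (volume.restrict (Metric.closedBall (0 : Pos) R))) := by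
    rw [Measure.prod_restrict]
    refine h1.mono_measure (Measure.restrict_mono ?_ le_rfl)
    exact prod_mono le_rfl (Metric.closedBall_subset_ball (by linarith))
  rw [timePhaseMeasure_restrict_testRegion, phaseMeasure_restrict_testRegion]
  exact (h2.comp_fst ((volume.restrict (Icc (0 : ℝ) 1)).prod
    (volume.restrict (Metric.closedBall (0 : Vel) R)))).comp_measurePreserving
    measurePreserving_timePhase_regroup

/-- On the support of `dψ` both `ξ` and `v` are bounded, so the function is at most a constant times
`1 + |E|`, with `E` needed only locally in `ξ`. -/
theorem IsTest.memLp_transport {T : ℝ} {ψ : Pos × ℝ × ℝ → ℝ} (hψ : IsTest T ψ)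
    {E : ℝ → Pos → Pos} (hE : MemL2L2loc T E) :
    MemLp (fun q : ℝ × Phase => fderiv ℝ ψ (macroPoint q.1 q.2) (macroDir (E q.1) q.2)) 2
      (timePhaseMeasure T) := by
  obtain ⟨R, M, hR, hM, -, hb, -, hz⟩ := hψ.exists_bounds
  have hEm := hE.memLp_phase (R + 2)
  set S : Set (ℝ × Phase) := univ ×ˢ testRegion (R + 2) with hS
  have mS : MeasurableSet S := MeasurableSet.univ.prod (measurableSet_testRegion _)
  have hcont : Continuous (fderiv ℝ ψ) := hψ.contDiff.continuous_fderiv (by norm_num)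
  have hind : (fun q : ℝ × Phase => fderiv ℝ ψ (macroPoint q.1 q.2) (macroDir (E q.1) q.2)) =
      S.indicator fun q => fderiv ℝ ψ (macroPoint q.1 q.2) (macroDir (E q.1) q.2) := by
    refine (indicator_eq_self.2 fun q hq => ?_).symm
    by_contra hqS
    refine hq ?_
    have : q.2 ∉ testRegion (R + 2) := fun h => hqS ⟨mem_univ _, h⟩
    simp only [eq_zero_of_notMem_testRegion hR hz q.1 this, zero_apply]
  rw [hind, memLp_indicator_iff_restrict mS]
  have hpar : AEStronglyMeasurable (fun q : ℝ × Phase => par q.2.2.2)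
      ((timePhaseMeasure T).restrict S) :=
    (continuous_par.comp (by fun_prop)).aestronglyMeasurable
  have hdir : AEStronglyMeasurable (fun q : ℝ × Phase => macroDir (E q.1) q.2)
      ((timePhaseMeasure T).restrict S) :=
    hpar.prodMk ((hpar.inner hEm.1).prodMk aestronglyMeasurable_const)
  have hmeas : AEStronglyMeasurable
      (fun q : ℝ × Phase => fderiv ℝ ψ (macroPoint q.1 q.2) (macroDir (E q.1) q.2))
      ((timePhaseMeasure T).restrict S) :=
    isBoundedBilinearMap_apply.continuous.comp_aestronglyMeasurable
      ((hcont.comp continuous_macroPoint).aestronglyMeasurable.prodMk hdir)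
  have hdom : MemLp (fun q : ℝ × Phase => M * ((R + 2) * (1 + ‖E q.1 q.2.2.1‖))) 2
      ((timePhaseMeasure T).restrict S) :=
    (((memLp_const (1 : ℝ)).add hEm.norm).const_mul (R + 2)).const_mul M
  refine hdom.mono hmeas ?_
  filter_upwards [ae_restrict_mem mS] with q hq
  have hv : ‖q.2.2.2‖ ≤ R + 2 := by simpa using hq.2.2.2
  have hp : ‖par q.2.2.2‖ ≤ R + 2 := (norm_par_le _).trans hv
  have h1 : ‖macroDir (E q.1) q.2‖ ≤ (R + 2) * (1 + ‖E q.1 q.2.2.1‖) := by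
    have h0 : 0 ≤ ‖E q.1 q.2.2.1‖ := norm_nonneg _
    refine max_le ?_ (max_le ?_ ?_)
    · exact hp.trans (by nlinarith)
    · exact (norm_inner_le_norm _ _).trans
        (mul_le_mul hp (by linarith) h0 (by linarith))
    · simp only [macroDir, norm_zero]
      positivity
  refine ((fderiv ℝ ψ (macroPoint q.1 q.2)).le_opNorm _).trans ((mul_le_mul (hb _) h1
    (norm_nonneg _) hM).trans (le_abs_self _))

/-! ### The weak form on phase space -/

/-- Integration by parts in time for a function that is a primitive almost everywhere. -/
theorem setIntegral_primitive_mul_deriv {T : ℝ} (hT : 0 < T) {H f η : ℝ → ℝ} {a c : ℝ}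
    (hH : IntegrableOn H (Ioo 0 T)) (hη : ContDiff ℝ 1 η) (hηT : η T = 0)
    (hf : ∀ᵐ t ∂(volume.restrict (Ioo 0 T)), f t = a - c * ∫ s in (0 : ℝ)..t, H s) :
    ∫ t in Ioo 0 T, f t * deriv η t = -(a * η 0) + c * ∫ t in Ioo 0 T, H t * η t := by
  have hHi : IntervalIntegrable H volume 0 T :=
    (intervalIntegrable_iff_integrableOn_Ioo_of_le hT.le).2 hH
  -- The primitive of an integrable function is only absolutely continuous, so integration by parts
  -- is used in that class; its derivative is `H` almost everywhere.
  have hG := hHi.absolutelyContinuousOnInterval_intervalIntegral (c := 0) (by simp)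
  have hηac : AbsolutelyContinuousOnInterval η 0 T :=
    hη.contDiffOn.absolutelyContinuousOnInterval
  have h1 := hG.integral_mul_deriv_eq_deriv_mul hηac
  have h2 : ∫ t in (0 : ℝ)..T, deriv (fun x => ∫ s in (0 : ℝ)..x, H s) t * η t =
      ∫ t in (0 : ℝ)..T, H t * η t := by
    refine intervalIntegral.integral_congr_ae ?_
    filter_upwards [hHi.ae_hasDerivAt_integral] with t ht hmem
    rw [(ht (uIoc_subset_uIcc hmem) 0 (by simp)).deriv]
  have hη' : Continuous (deriv η) := hη.continuous_deriv le_rfl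
  have h3 : ∫ t in (0 : ℝ)..T, deriv η t = -η 0 := by
    rw [intervalIntegral.integral_deriv_eq_sub
      (fun x _ => (hη.differentiable (by norm_num)).differentiableAt)
      (hη'.intervalIntegrable _ _), hηT, zero_sub]
  have hGi : IntervalIntegrable (fun t => (∫ s in (0 : ℝ)..t, H s) * deriv η t) volume 0 T :=
    (hG.continuousOn.mul hη'.continuousOn).intervalIntegrable
  have hint : ∀ φ : ℝ → ℝ, ∫ t in Ioo 0 T, φ t = ∫ t in (0 : ℝ)..T, φ t := fun φ => by
    rw [intervalIntegral.integral_of_le hT.le, integral_Ioc_eq_integral_Ioo]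
  have h4 : ∫ t in Ioo 0 T, f t * deriv η t =
      ∫ t in Ioo 0 T, (a * deriv η t - c * ((∫ s in (0 : ℝ)..t, H s) * deriv η t)) := by
    refine integral_congr_ae ?_
    filter_upwards [hf] with t ht
    rw [ht]
    ring
  rw [h4, hint, hint, intervalIntegral.integral_sub
    ((hη'.intervalIntegrable _ _).const_mul a) (hGi.const_mul c),
    intervalIntegral.integral_const_mul, intervalIntegral.integral_const_mul, h3, h1, h2, hηT]
  simp

theorem IsTest.deriv_macroPoint {T : ℝ} {ψ : Pos × ℝ × ℝ → ℝ} (hψ : IsTest T ψ) (p : Phase)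
    (t : ℝ) :
    deriv (fun t => ψ (macroPoint t p)) t = fderiv ℝ ψ (macroPoint t p) (0, 0, 1) := by
  have h1 : HasDerivAt (fun t => macroPoint t p) (0, 0, 1) t :=
    (hasDerivAt_const t _).prodMk ((hasDerivAt_const t _).prodMk (hasDerivAt_id t))
  exact (((hψ.contDiff.differentiable (by norm_num)) _).hasFDerivAt.comp_hasDerivAt t h1).deriv

theorem IsTest.apply_final {T : ℝ} {ψ : Pos × ℝ × ℝ → ℝ} (hψ : IsTest T ψ) (p : Phase) :
    ψ (macroPoint T p) = 0 := by
  refine image_eq_zero_of_notMem_tsupport fun h => ?_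
  exact lt_irrefl T (hψ.support h)

theorem continuous_fderiv_apply_const {ψ : Pos × ℝ × ℝ → ℝ} {T : ℝ} (hψ : IsTest T ψ)
    (w : Pos × ℝ × ℝ) : Continuous fun p => fderiv ℝ ψ p w :=
  (hψ.contDiff.continuous_fderiv (by norm_num)).clm_apply continuous_const

theorem IsTest.exists_bounds_apply {T : ℝ} {ψ : Pos × ℝ × ℝ → ℝ} (hψ : IsTest T ψ)
    (w : Pos × ℝ × ℝ) : ∃ R M : ℝ, 0 < R ∧ (∀ p, |fderiv ℝ ψ p w| ≤ M) ∧
      ∀ p, R ≤ ‖p‖ → fderiv ℝ ψ p w = 0 := by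
  obtain ⟨R, M, hR, hM, -, hb, -, hz⟩ := hψ.exists_bounds
  refine ⟨R, M * ‖w‖, hR, fun p => ((fderiv ℝ ψ p).le_opNorm w).trans ?_, fun p hp => by
    rw [hz p hp, zero_apply]⟩
  gcongr
  exact hb p

theorem IsTest.memLp_fderiv {T : ℝ} {ψ : Pos × ℝ × ℝ → ℝ} (hψ : IsTest T ψ) (w : Pos × ℝ × ℝ) :
    MemLp (fun q : ℝ × Phase => fderiv ℝ ψ (macroPoint q.1 q.2) w) 2 (timePhaseMeasure T) := by
  obtain ⟨R, M, hR, hb, hz⟩ := hψ.exists_bounds_apply w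
  exact memLp_macroPoint (continuous_fderiv_apply_const hψ w) hR hb hz T

theorem IsTest.memLp {T : ℝ} {ψ : Pos × ℝ × ℝ → ℝ} (hψ : IsTest T ψ) :
    MemLp (fun q : ℝ × Phase => ψ (macroPoint q.1 q.2)) 2 (timePhaseMeasure T) := by
  obtain ⟨R, M, hR, hM, hb, -, hz, -⟩ := hψ.exists_bounds
  exact memLp_macroPoint hψ.contDiff.continuous hR hb hz T

theorem IsTest.memLp_slice {T : ℝ} {ψ : Pos × ℝ × ℝ → ℝ} (hψ : IsTest T ψ) (t : ℝ) :
    MemLp (fun p => ψ (macroPoint t p)) 2 phaseMeasure := by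
  obtain ⟨R, M, hR, hM, hb, -, hz, -⟩ := hψ.exists_bounds
  exact memLp_macroPoint_slice hψ.contDiff.continuous hR hb hz t

/-- This permits the integration by parts in time at a fixed phase point. -/
theorem ae_integrableOn_time {T : ℝ} {h : ℝ → Phase → ℝ} (hh : MemLinftyL2 T h) :
    ∀ᵐ p ∂phaseMeasure, IntegrableOn (fun t => h t p) (Ioo 0 T) := by
  have h1 := hh.memLp
  have h2 := h1.integrable_sq
  have h3 : ∀ᵐ p ∂phaseMeasure, AEStronglyMeasurable (fun t => h t p)
      (volume.restrict (Ioo 0 T)) := h1.1.prod_swap.prodMk_left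
  have h4 : ∀ᵐ p ∂phaseMeasure, Integrable (fun t => h t p ^ 2) (volume.restrict (Ioo 0 T)) :=
    h2.prod_left_ae
  have : IsFiniteMeasure (volume.restrict (Ioo 0 T)) := ⟨by simp⟩
  filter_upwards [h3, h4] with p hm hi
  exact ((memLp_two_iff_integrable_sq hm).2 hi).integrable (by norm_num)

theorem restrict_Ioo_prod_univ (T : ℝ) :
    (volume : Measure (ℝ × Pos × Vel)).restrict (Ioo 0 T ×ˢ univ) =
      (volume.restrict (Ioo 0 T)).prod volume := by
  rw [Measure.volume_eq_prod ℝ (Pos × Vel), ← Measure.prod_restrict, Measure.restrict_univ]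

/-- Green's formula for a solution, at almost every time. -/
theorem ae_green_slice {α T : ℝ} {K : Pos → ℝ → Vel → Vel → ℝ} (hK : IsReflectionKernel K)
    {B : Pos → ℝ} {f h : ℝ → Phase → ℝ} {g : ℝ → Fin 2 → Pos × Vel → ℝ} {E : ℝ → Pos → Pos}
    (hg : ∀ᵐ t ∂(volume.restrict (Ioo 0 T)), HasTransportAndTrace α (E t) B (f t) (h t) (g t))
    (hgm : ∀ i, AEStronglyMeasurable (fun q : ℝ × Pos × Vel => g q.1 i q.2)
      (volume.restrict (Ioo 0 T ×ˢ univ)))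
    (hsq : ∀ (i : Fin 2) (R : ℝ),
      ∫⁻ q in Ioo 0 T ×ˢ {q : Pos × Vel | ‖q.2‖ ≤ R},
        ENNReal.ofReal (|q.2.2 0| * g q.1 i q.2 ^ 2) < ⊤)
    (hbc : ∀ i, ∀ᵐ q : ℝ × Pos × Vel ∂(volume.restrict (Ioo 0 T ×ˢ univ)), Incoming i q.2.2 →
      g q.1 i q.2 = boundaryOp K i q.2.1 (fun v => g q.1 i (q.2.1, v)) q.2.2)
    {ψ : Pos × ℝ × ℝ → ℝ} (hψ : IsTest T ψ) :
    ∀ᵐ t ∂(volume.restrict (Ioo 0 T)), (∫ p, h t p * ψ (macroPoint t p) ∂phaseMeasure) +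
      ∫ p, f t p * fderiv ℝ ψ (macroPoint t p) (macroDir (E t) p) ∂phaseMeasure = 0 := by
  simp only [restrict_Ioo_prod_univ] at hgm hbc
  have h1 : ∀ᵐ t ∂(volume.restrict (Ioo 0 T)), ∀ i, AEStronglyMeasurable (g t i) :=
    ae_all_iff.2 fun i => (hgm i).prodMk_left
  have h2 : ∀ᵐ t ∂(volume.restrict (Ioo 0 T)), ∀ i, ∀ᵐ q : Pos × Vel, Incoming i q.2 →
      g t i q = boundaryOp K i q.1 (fun v => g t i (q.1, v)) q.2 :=
    ae_all_iff.2 fun i => Measure.ae_ae_of_ae_prod (hbc i)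
  -- Restricting to integer radii keeps the union of exceptional sets of times a null set.
  have h3 : ∀ᵐ t ∂(volume.restrict (Ioo 0 T)), ∀ i, ∀ n : ℕ,
      ∫⁻ q in {q : Pos × Vel | ‖q.2‖ ≤ n}, ENNReal.ofReal (|q.2 0| * g t i q ^ 2) < ⊤ := by
    refine ae_all_iff.2 fun i => ae_all_iff.2 fun n => ?_
    have hfin := hsq i n
    have hm : AEMeasurable (fun q : ℝ × Pos × Vel =>
        ENNReal.ofReal (|q.2.2 0| * g q.1 i q.2 ^ 2))
        ((volume.restrict (Ioo 0 T)).prod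
          (volume.restrict {q : Pos × Vel | ‖q.2‖ ≤ (n : ℝ)})) := by
      have h5 : AEMeasurable (fun q : ℝ × Pos × Vel => g q.1 i q.2)
          ((volume.restrict (Ioo 0 T)).prod volume) := (hgm i).aemeasurable
      have h6 : AEMeasurable (fun q : ℝ × Pos × Vel =>
          ENNReal.ofReal (|q.2.2 0| * g q.1 i q.2 ^ 2))
          ((volume.restrict (Ioo 0 T)).prod volume) := by fun_prop
      refine h6.mono_measure ?_
      gcongr
      exact Measure.restrict_le_self
    rw [Measure.volume_eq_prod ℝ (Pos × Vel), ← Measure.prod_restrict, lintegral_prod _ hm] at hfin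
    exact ae_lt_top' hm.lintegral_prod_right' hfin.ne
  filter_upwards [hg, h1, h2, h3] with t hg' h1' h2' h3'
  exact green_slice hK hψ t hg' h1' h3' h2'

/-- The weak form of a solution against functions of position and energy, on phase space. -/
theorem phase_weak_form {α T : ℝ} (hT : 0 < T) {K : Pos → ℝ → Vel → Vel → ℝ}
    (hK : IsReflectionKernel K) {B C : Pos → ℝ} {FI : Pos → ℝ → ℝ}
    (hFI : MemLp (initialDatum FI) 2 phaseMeasure)
    {f : ℝ → Phase → ℝ} {φ : ℝ → Pos → ℝ} {E : ℝ → Pos → Pos}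
    (hs : IsSolution α T K B C FI f φ E) {ψ : Pos × ℝ × ℝ → ℝ} (hψ : IsTest T ψ) :
    (∫ q : ℝ × Phase, f q.1 q.2 * fderiv ℝ ψ (macroPoint q.1 q.2) (0, 0, 1) ∂timePhaseMeasure T) +
      α⁻¹ * (∫ q : ℝ × Phase, f q.1 q.2 *
        fderiv ℝ ψ (macroPoint q.1 q.2) (macroDir (E q.1) q.2) ∂timePhaseMeasure T) +
      ∫ p, initialDatum FI p * ψ (macroPoint 0 p) ∂phaseMeasure = 0 := by
  obtain ⟨h, g, hh, hev, hg, hgm, hsq, hbc⟩ := hs.vlasov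
  have hf := hs.memLp.memLp
  have hgreen := ae_green_slice hK hg hgm hsq hbc hψ
  have i1 : Integrable (fun q : ℝ × Phase =>
      f q.1 q.2 * fderiv ℝ ψ (macroPoint q.1 q.2) (0, 0, 1)) (timePhaseMeasure T) :=
    hf.integrable_mul (hψ.memLp_fderiv _)
  have i2 : Integrable (fun q : ℝ × Phase => f q.1 q.2 *
      fderiv ℝ ψ (macroPoint q.1 q.2) (macroDir (E q.1) q.2)) (timePhaseMeasure T) :=
    hf.integrable_mul (hψ.memLp_transport hs.field)
  have i3 : Integrable (fun q : ℝ × Phase => h q.1 q.2 * ψ (macroPoint q.1 q.2))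
      (timePhaseMeasure T) := hh.memLp.integrable_mul hψ.memLp
  have i4 : Integrable (fun p => initialDatum FI p * ψ (macroPoint 0 p)) phaseMeasure :=
    hFI.integrable_mul (hψ.memLp_slice 0)
  -- Fubini with time outermost: the Green identity of each time slice is integrated.
  have e1 : ∫ q : ℝ × Phase, h q.1 q.2 * ψ (macroPoint q.1 q.2) ∂timePhaseMeasure T =
      -∫ q : ℝ × Phase, f q.1 q.2 *
        fderiv ℝ ψ (macroPoint q.1 q.2) (macroDir (E q.1) q.2) ∂timePhaseMeasure T := by
    rw [timePhaseMeasure] at i2 i3 ⊢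
    rw [integral_prod _ i2, integral_prod _ i3, ← integral_neg]
    refine integral_congr_ae ?_
    filter_upwards [hgreen] with t ht using eq_neg_of_add_eq_zero_left ht
  have hev' : ∀ᵐ p ∂phaseMeasure, ∀ᵐ t ∂(volume.restrict (Ioo 0 T)),
      f t p = initialDatum FI p - α⁻¹ * ∫ s in (0 : ℝ)..t, h s p :=
    Measure.ae_ae_of_ae_prod (Measure.measurePreserving_swap.quasiMeasurePreserving.ae hev)
  -- Fubini with the phase point outermost: integration by parts in time leaves only the endpoint `t
  -- = 0`, since `ψ` vanishes at `t = T`.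
  have e2 : ∫ q : ℝ × Phase, f q.1 q.2 * fderiv ℝ ψ (macroPoint q.1 q.2) (0, 0, 1)
        ∂timePhaseMeasure T =
      -(∫ p, initialDatum FI p * ψ (macroPoint 0 p) ∂phaseMeasure) +
        α⁻¹ * ∫ q : ℝ × Phase, h q.1 q.2 * ψ (macroPoint q.1 q.2) ∂timePhaseMeasure T := by
    have i5 : Integrable (fun p => -(initialDatum FI p * ψ (macroPoint 0 p))) phaseMeasure :=
      i4.neg
    rw [timePhaseMeasure] at i1 i3 ⊢
    rw [integral_prod_symm _ i1, integral_prod_symm _ i3, ← integral_const_mul, ← integral_neg,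
      ← integral_add i5 (i3.integral_prod_right.const_mul _)]
    refine integral_congr_ae ?_
    filter_upwards [hev', ae_integrableOn_time hh] with p h1 h2
    have hη : ContDiff ℝ 1 fun t => ψ (macroPoint t p) := by
      refine (hψ.contDiff.of_le (by norm_num)).comp ?_
      exact contDiff_const.prodMk (contDiff_const.prodMk contDiff_id)
    have h3 := setIntegral_primitive_mul_deriv hT h2 hη (hψ.apply_final p) h1
    simp only [hψ.deriv_macroPoint] at h3
    exact h3
  rw [e2, e1]
  ring

/-! ### From phase space to position and energy -/

/-- The domain `ℝ² × (0, ∞) × (0, T)`. -/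
def macroDomain (T : ℝ) : Set (Pos × ℝ × ℝ) := univ ×ˢ Ioi 0 ×ˢ Ioo 0 T

theorem measurableSet_macroDomain (T : ℝ) : MeasurableSet (macroDomain T) :=
  MeasurableSet.univ.prod (measurableSet_Ioi.prod measurableSet_Ioo)

/-- The weight `√(2ε)` is positive on the domain, so almost-everywhere statements from Fubini pass
back to Lebesgue measure. -/
theorem absolutelyContinuous_macroMeasure (T : ℝ) :
    volume.restrict (macroDomain T) ≪ macroMeasure T := by
  rw [macroMeasure_eq_withDensity]
  refine withDensity_absolutelyContinuous' (by fun_prop) ?_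
  filter_upwards [ae_restrict_mem (measurableSet_macroDomain T)] with p hp
  have : 0 < p.2.1 := hp.2.1
  simp only [ne_eq, ENNReal.ofReal_eq_zero, not_le]
  positivity

theorem integrable_macroMeasure_iff {T : ℝ} {u : Pos × ℝ × ℝ → ℝ} :
    Integrable u (macroMeasure T) ↔
      IntegrableOn (fun p => √(2 * p.2.1) * u p) (macroDomain T) := by
  rw [macroMeasure_eq_withDensity, integrable_withDensity_iff_integrable_smul' (by fun_prop)
    (Eventually.of_forall fun _ => ENNReal.ofReal_lt_top)]
  simp only [ENNReal.toReal_ofReal (Real.sqrt_nonneg _), smul_eq_mul]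
  rfl

theorem integral_macroMeasure (T : ℝ) (u : Pos × ℝ × ℝ → ℝ) :
    ∫ p, u p ∂macroMeasure T = ∫ p in macroDomain T, √(2 * p.2.1) * u p := by
  rw [macroMeasure_eq_withDensity, integral_withDensity_eq_integral_toReal_smul (by fun_prop)
    (Eventually.of_forall fun _ => ENNReal.ofReal_lt_top)]
  simp only [ENNReal.toReal_ofReal (Real.sqrt_nonneg _), smul_eq_mul]
  rfl

/-- Integration over time and phase space in the variables `(ξ, ε, t)` and `(x, ω)`. -/
theorem integral_timePhase_eq {T : ℝ} {G : ℝ × Phase → ℝ} (hG : Integrable G (timePhaseMeasure T)) :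
    IntegrableOn (fun p => √(2 * p.2.1) * ∫ y, G (timePhasePolar (p, y)) ∂slabSphere)
      (macroDomain T) ∧
    ∫ p in macroDomain T, √(2 * p.2.1) * ∫ y, G (timePhasePolar (p, y)) ∂slabSphere =
      ∫ q, G q ∂timePhaseMeasure T := by
  have hP := measurePreserving_timePhasePolar T
  have hG' := hP.integrable_comp_of_integrable hG
  simp only [Function.comp_def] at hG'
  refine ⟨integrable_macroMeasure_iff.1 hG'.integral_prod_left, ?_⟩
  rw [← integral_macroMeasure, ← hP.map_eq, integral_map hP.aemeasurable
    (by rw [hP.map_eq]; exact hG.1), integral_prod _ hG']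

/-- Integration over phase space in the variables `(ξ, ε)` and `(x, ω)`. -/
theorem integral_phase_eq {G : Phase → ℝ} (hG : Integrable G phaseMeasure) :
    IntegrableOn (fun p : Pos × ℝ => √(2 * p.2) * ∫ y, G (phasePolar (p, y)) ∂slabSphere)
      (univ ×ˢ Ioi 0) ∧
    ∫ p : Pos × ℝ in univ ×ˢ Ioi 0, √(2 * p.2) * ∫ y, G (phasePolar (p, y)) ∂slabSphere =
      ∫ q, G q ∂phaseMeasure := by
  have hP := measurePreserving_phasePolar
  have hG' := hP.integrable_comp_of_integrable hG
  simp only [Function.comp_def] at hG'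
  have h1 := hG'.integral_prod_left
  have h2 : ∫ q, G q ∂phaseMeasure =
      ∫ p, ∫ y, G (phasePolar (p, y)) ∂slabSphere ∂posEnergyMeasure := by
    rw [← hP.map_eq, integral_map hP.aemeasurable (by rw [hP.map_eq]; exact hG.1),
      integral_prod _ hG']
  rw [h2]
  rw [posEnergyMeasure_eq_withDensity] at h1 ⊢
  rw [integrable_withDensity_iff_integrable_smul' (by fun_prop)
    (Eventually.of_forall fun _ => ENNReal.ofReal_lt_top)] at h1
  rw [integral_withDensity_eq_integral_toReal_smul (by fun_prop)
    (Eventually.of_forall fun _ => ENNReal.ofReal_lt_top)]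
  simp only [ENNReal.toReal_ofReal (Real.sqrt_nonneg _), smul_eq_mul] at h1
  exact ⟨h1, by simp only [ENNReal.toReal_ofReal (Real.sqrt_nonneg _), smul_eq_mul]⟩

theorem macroPoint_timePhasePolar {p : Pos × ℝ × ℝ} (hp : 0 ≤ p.2.1) (y : ℝ × Dir) :
    macroPoint (timePhasePolar (p, y)).1 (timePhasePolar (p, y)).2 = p := by
  simp only [macroPoint, timePhasePolar, phasePolar, norm_sqrt_smul_dir_sq_half hp]

theorem macroPoint_phasePolar {p : Pos × ℝ} (hp : 0 ≤ p.2) (t : ℝ) (y : ℝ × Dir) :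
    macroPoint t (phasePolar (p, y)) = (p.1, p.2, t) := by
  simp only [macroPoint, phasePolar, norm_sqrt_smul_dir_sq_half hp]

/-- Fubini for `f²` in polar coordinates. It makes the averages over `(x, ω)` genuine integrals at
almost every `(ξ, ε, t)`. -/
theorem ae_memLp_fiber {T : ℝ} {f : ℝ → Phase → ℝ} (hf : MemLinftyL2 T f) :
    ∀ᵐ p ∂(volume.restrict (macroDomain T)), MemLp (fun y : ℝ × Dir =>
      f p.2.2 (y.1, p.1, √(2 * p.2.1) • (y.2 : Vel))) 2 slabSphere := by
  refine (absolutelyContinuous_macroMeasure T).ae_le ?_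
  have h1 := hf.memLp.comp_measurePreserving (measurePreserving_timePhasePolar T)
  filter_upwards [h1.1.prodMk_left, h1.integrable_sq.prod_right_ae] with p hm hi
  exact (memLp_two_iff_integrable_sq hm).2 hi

/-- The factor `∂ₜψ` is constant along each fibre in `(x, ω)`, so only `f` is averaged. -/
theorem avgDensity_part {T : ℝ} {f : ℝ → Phase → ℝ} (hf : MemLinftyL2 T f)
    {ψ : Pos × ℝ × ℝ → ℝ} (hψ : IsTest T ψ) :
    IntegrableOn (fun p => 4 * Real.pi * √(2 * p.2.1) * avgDensity f p.1 p.2.1 p.2.2 *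
      fderiv ℝ ψ p (0, 0, 1)) (macroDomain T) ∧
    ∫ p in macroDomain T, 4 * Real.pi * √(2 * p.2.1) * avgDensity f p.1 p.2.1 p.2.2 *
      fderiv ℝ ψ p (0, 0, 1) =
    ∫ q : ℝ × Phase, f q.1 q.2 * fderiv ℝ ψ (macroPoint q.1 q.2) (0, 0, 1)
      ∂timePhaseMeasure T := by
  have h := integral_timePhase_eq (G := fun q : ℝ × Phase =>
    f q.1 q.2 * fderiv ℝ ψ (macroPoint q.1 q.2) (0, 0, 1))
    (hf.memLp.integrable_mul (hψ.memLp_fderiv _))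
  have hpt : ∀ p ∈ macroDomain T, 4 * Real.pi * √(2 * p.2.1) * avgDensity f p.1 p.2.1 p.2.2 *
      fderiv ℝ ψ p (0, 0, 1) = √(2 * p.2.1) * ∫ y, f (timePhasePolar (p, y)).1
        (timePhasePolar (p, y)).2 * fderiv ℝ ψ (macroPoint (timePhasePolar (p, y)).1
          (timePhasePolar (p, y)).2) (0, 0, 1) ∂slabSphere := by
    intro p hp
    have hp : 0 < p.2.1 := hp.2.1
    simp only [macroPoint_timePhasePolar hp.le, integral_mul_const]
    rw [avgDensity]
    have := Real.pi_ne_zero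
    field_simp
    exact mul_comm _ _
  rw [← h.2, setIntegral_congr_fun (measurableSet_macroDomain T) hpt,
    integrableOn_congr_fun hpt (measurableSet_macroDomain T)]
  exact ⟨h.1, rfl⟩

/-- The initial datum is constant on the fibres, whose total mass is `4π`. -/
theorem initial_part {T : ℝ} {FI : Pos → ℝ → ℝ} (hFI : MemLp (initialDatum FI) 2 phaseMeasure)
    {ψ : Pos × ℝ × ℝ → ℝ} (hψ : IsTest T ψ) :
    IntegrableOn (fun p : Pos × ℝ => 4 * Real.pi * √(2 * p.2) * FI p.1 p.2 * ψ (p.1, p.2, 0))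
      (univ ×ˢ Ioi 0) ∧
    ∫ p : Pos × ℝ in univ ×ˢ Ioi 0, 4 * Real.pi * √(2 * p.2) * FI p.1 p.2 * ψ (p.1, p.2, 0) =
      ∫ p, initialDatum FI p * ψ (macroPoint 0 p) ∂phaseMeasure := by
  have h := integral_phase_eq (G := fun p => initialDatum FI p * ψ (macroPoint 0 p))
    (hFI.integrable_mul (hψ.memLp_slice 0))
  have mS : MeasurableSet ((univ : Set Pos) ×ˢ Ioi (0 : ℝ)) :=
    MeasurableSet.univ.prod measurableSet_Ioi
  have hpt : ∀ p ∈ (univ : Set Pos) ×ˢ Ioi (0 : ℝ),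
      4 * Real.pi * √(2 * p.2) * FI p.1 p.2 * ψ (p.1, p.2, 0) =
        √(2 * p.2) * ∫ y, initialDatum FI (phasePolar (p, y)) * ψ (macroPoint 0 (phasePolar (p, y)))
          ∂slabSphere := by
    intro p hp
    have hp : 0 < p.2 := hp.2
    have h1 : ∀ y, initialDatum FI (phasePolar (p, y)) = FI p.1 p.2 := fun y => by
      simp only [initialDatum, phasePolar, norm_sqrt_smul_dir_sq_half hp.le]
    simp only [macroPoint_phasePolar hp.le, h1, integral_const, slabSphere_real_univ, smul_eq_mul]
    ring
  rw [← h.2, setIntegral_congr_fun mS hpt, integrableOn_congr_fun hpt mS]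
  exact ⟨h.1, rfl⟩

theorem par_smul (c : ℝ) (v : Vel) : par (c • v) = c • par v := by
  ext i
  fin_cases i <;> simp [par]

/-- The functional `a ↦ a · (∇_ξ + e ∂_ε)ψ` at a point, where `L` is the derivative of `ψ`. -/
def driftFunctional (L : Pos × ℝ × ℝ →L[ℝ] ℝ) (e : Pos) : Pos →L[ℝ] ℝ :=
  L.comp ((ContinuousLinearMap.id ℝ Pos).prod ((innerSL ℝ e).prod 0))

theorem driftFunctional_apply (L : Pos × ℝ × ℝ →L[ℝ] ℝ) (e a : Pos) :
    driftFunctional L e a = L (a, 0, 0) + inner ℝ a e * L (0, 1, 0) := by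
  have h1 : driftFunctional L e a = L (a, inner ℝ a e, 0) := by
    simp [driftFunctional, real_inner_comm]
  have h2 : (a, inner ℝ a e, (0 : ℝ)) = (a, (0 : ℝ), (0 : ℝ)) +
      inner ℝ a e • ((0 : Pos), (1 : ℝ), (0 : ℝ)) := by
    simp
  rw [h1, h2, map_add, map_smul, smul_eq_mul]

theorem apply_macroDir (L : Pos × ℝ × ℝ →L[ℝ] ℝ) (E : Pos → Pos) (p : Phase) :
    L (macroDir E p) = driftFunctional L (E p.2.1) (par p.2.2) := by
  simp [driftFunctional, macroDir, real_inner_comm]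

theorem norm_par_dir_le (ω : Dir) : ‖par (ω : Vel)‖ ≤ 1 :=
  (norm_par_le _).trans (by simp)

theorem integrable_fiber_smul_par {u : ℝ × Dir → ℝ} (hu : Integrable u slabSphere) :
    Integrable (fun y => u y • par (y.2 : Vel)) slabSphere := by
  have hc : Continuous fun y : ℝ × Dir => par (y.2 : Vel) := continuous_par.comp (by fun_prop)
  refine hu.norm.mono' (hu.1.smul hc.aestronglyMeasurable) (Eventually.of_forall fun y => ?_)
  rw [norm_smul]
  exact mul_le_of_le_one_right (norm_nonneg _) (norm_par_dir_le _)

theorem current_part {α T : ℝ} {f : ℝ → Phase → ℝ} (hf : MemLinftyL2 T f)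
    {E : ℝ → Pos → Pos} (hE : MemL2L2loc T E) {ψ : Pos × ℝ × ℝ → ℝ} (hψ : IsTest T ψ) :
    IntegrableOn (fun p => driftFunctional (fderiv ℝ ψ p) (E p.2.2 p.1)
      (current α f p.1 p.2.1 p.2.2)) (macroDomain T) ∧
    ∫ p in macroDomain T, driftFunctional (fderiv ℝ ψ p) (E p.2.2 p.1)
      (current α f p.1 p.2.1 p.2.2) =
    α⁻¹ * ∫ q : ℝ × Phase, f q.1 q.2 * fderiv ℝ ψ (macroPoint q.1 q.2) (macroDir (E q.1) q.2)
      ∂timePhaseMeasure T := by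
  have h := integral_timePhase_eq (G := fun q : ℝ × Phase =>
    α⁻¹ * (f q.1 q.2 * fderiv ℝ ψ (macroPoint q.1 q.2) (macroDir (E q.1) q.2)))
    ((hf.memLp.integrable_mul (hψ.memLp_transport hE)).const_mul _)
  have hpt : ∀ᵐ p ∂(volume.restrict (macroDomain T)),
      driftFunctional (fderiv ℝ ψ p) (E p.2.2 p.1) (current α f p.1 p.2.1 p.2.2) =
      √(2 * p.2.1) * ∫ y, α⁻¹ * (f (timePhasePolar (p, y)).1
        (timePhasePolar (p, y)).2 * fderiv ℝ ψ (macroPoint (timePhasePolar (p, y)).1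
          (timePhasePolar (p, y)).2) (macroDir (E (timePhasePolar (p, y)).1)
            (timePhasePolar (p, y)).2)) ∂slabSphere := by
    filter_upwards [ae_restrict_mem (measurableSet_macroDomain T), ae_memLp_fiber hf] with p hp hi
    have hp : 0 < p.2.1 := hp.2.1
    have hi' := integrable_fiber_smul_par (hi.integrable (by norm_num))
    simp only [macroPoint_timePhasePolar hp.le, integral_const_mul, apply_macroDir]
    simp only [timePhasePolar, phasePolar, par_smul, map_smul, smul_eq_mul]
    -- The drift functional is the same along the whole fibre and commutes with the vector-valued
    -- integral, which is where fibre integrability enters.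
    rw [current, map_smul, ← ContinuousLinearMap.integral_comp_comm _ hi', smul_eq_mul]
    simp only [map_smul, smul_eq_mul, mul_left_comm _ √(2 * p.2.1), integral_const_mul]
    rw [← mul_assoc √(2 * p.2.1), ← mul_assoc, mul_comm _ α⁻¹, ← mul_assoc]
    -- One `√(2ε)` is the polar density, the other the length of `v`.
    have : 2 * p.2.1 / α = α⁻¹ * (√(2 * p.2.1) * √(2 * p.2.1)) := by
      rw [Real.mul_self_sqrt (by positivity)]
      ring
    rw [this]
    ring
  rw [← integral_const_mul, ← h.2, integral_congr_ae hpt, IntegrableOn, integrable_congr hpt]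
  exact ⟨h.1, rfl⟩

theorem weakIntegrand_eq (F : Pos → ℝ → ℝ → ℝ) (J : Pos → ℝ → ℝ → Pos) (E : ℝ → Pos → Pos)
    (ψ : Pos × ℝ × ℝ → ℝ) :
    weakIntegrand F J E ψ = fun p =>
      4 * Real.pi * √(2 * p.2.1) * F p.1 p.2.1 p.2.2 * fderiv ℝ ψ p (0, 0, 1) +
        driftFunctional (fderiv ℝ ψ p) (E p.2.2 p.1) (J p.1 p.2.1 p.2.2) := by
  funext p
  rw [weakIntegrand, driftFunctional_apply]

theorem IsSolution.weakContinuityEq {α T : ℝ} (hT : 0 < T) {K : Pos → ℝ → Vel → Vel → ℝ}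
    (hK : IsReflectionKernel K) {B C : Pos → ℝ} {FI : Pos → ℝ → ℝ}
    (hFI : MemLp (initialDatum FI) 2 phaseMeasure)
    {f : ℝ → Phase → ℝ} {φ : ℝ → Pos → ℝ} {E : ℝ → Pos → Pos}
    (hs : IsSolution α T K B C FI f φ E) :
    WeakContinuityEq T (avgDensity f) (current α f) E FI := by
  intro ψ hψ
  obtain ⟨i1, e1⟩ := avgDensity_part hs.memLp hψ
  obtain ⟨i2, e2⟩ := current_part (α := α) hs.memLp hs.field hψ
  obtain ⟨i3, e3⟩ := initial_part hFI hψ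
  rw [weakIntegrand_eq]
  refine ⟨i1.add i2, i3, ?_⟩
  have key := phase_weak_form hT hK hFI hs hψ
  rw [← e1, ← e2, ← e3] at key
  exact (congrArg₂ (· + ·) (integral_add i1 i2) rfl).trans key

/-! ### The current is locally square integrable -/

/-- Cauchy–Schwarz against the constant `1`: with `V` the total mass and `I = ∫ |u|`, expand `∫
(V|u| - I)² ≥ 0` and divide by `V`; a zero measure is treated apart. -/
theorem sq_integral_abs_le {X : Type*} [MeasurableSpace X] {μ : Measure X} [IsFiniteMeasure μ]
    {u : X → ℝ} (hu : MemLp u 2 μ) :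
    (∫ x, |u x| ∂μ) ^ 2 ≤ μ.real univ * ∫ x, u x ^ 2 ∂μ := by
  have h1 : Integrable (fun x => |u x|) μ := (hu.integrable (by norm_num)).abs
  have h2 := hu.integrable_sq
  set I := ∫ x, |u x| ∂μ with hI
  set V := μ.real univ with hV
  have h3 : ∫ x, (V * |u x| - I) ^ 2 ∂μ = V * (V * (∫ x, u x ^ 2 ∂μ) - I ^ 2) := by
    have : ∀ x, (V * |u x| - I) ^ 2 = V ^ 2 * u x ^ 2 - 2 * V * I * |u x| + I ^ 2 := fun x => by
      rw [← sq_abs (u x)]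
      ring
    simp only [this]
    have h5 : Integrable (fun x => V ^ 2 * u x ^ 2 - 2 * V * I * |u x|) μ :=
      (h2.const_mul _).sub (h1.const_mul _)
    rw [integral_add h5 (integrable_const _), integral_sub (h2.const_mul _) (h1.const_mul _), integral_const_mul, integral_const_mul,
      integral_const, ← hI, ← hV, smul_eq_mul]
    ring
  have h4 : 0 ≤ V * (V * (∫ x, u x ^ 2 ∂μ) - I ^ 2) := by
    rw [← h3]
    exact integral_nonneg fun x => sq_nonneg _
  rcases (measureReal_nonneg : 0 ≤ V).eq_or_lt with hV0 | hVpos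
  · have hμ : μ = 0 := by
      rw [← Measure.measure_univ_eq_zero]
      exact (measureReal_eq_zero_iff (measure_ne_top _ _)).1 hV0.symm
    simp [hI, hμ]
  · linarith [nonneg_of_mul_nonneg_right h4 hVpos]

/-- Cauchy–Schwarz on the fibre bounds `|J|²` by a multiple of `(2ε/α)² ∫ f²`. Only `√(2ε) ∫ f²` is
known to be integrable, but `(2ε)²` is at most a constant times `√(2ε)` for `ε < R`. The bound
depends on `α`. -/
theorem current_memLp {α T : ℝ} {f : ℝ → Phase → ℝ} (hf : MemLinftyL2 T f) (R : ℝ) :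
    MemLp (fun p : Pos × ℝ × ℝ => current α f p.1 p.2.1 p.2.2) 2
      (volume.restrict (Metric.ball 0 R ×ˢ Ioo 0 R ×ˢ Ioo 0 T)) := by
  have mD : MeasurableSet ((Metric.ball (0 : Pos) R) ×ˢ Ioo (0 : ℝ) R ×ˢ Ioo (0 : ℝ) T) :=
    measurableSet_ball.prod (measurableSet_Ioo.prod measurableSet_Ioo)
  have hsub : (Metric.ball (0 : Pos) R) ×ˢ Ioo (0 : ℝ) R ×ˢ Ioo (0 : ℝ) T ⊆ macroDomain T :=
    prod_mono (subset_univ _) (prod_mono Ioo_subset_Ioi_self le_rfl)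
  have hfp := hf.memLp.comp_measurePreserving (measurePreserving_timePhasePolar T)
  have hc : Continuous fun z : (Pos × ℝ × ℝ) × (ℝ × Dir) => par (z.2.2 : Vel) :=
    continuous_par.comp (by fun_prop)
  have hm1 : AEStronglyMeasurable (fun p : Pos × ℝ × ℝ =>
      ∫ y, f p.2.2 (y.1, p.1, √(2 * p.2.1) • (y.2 : Vel)) • par (y.2 : Vel) ∂slabSphere)
      (macroMeasure T) :=
    (hfp.1.smul hc.aestronglyMeasurable).integral_prod_right'
  have hm2 : AEStronglyMeasurable (fun p : Pos × ℝ × ℝ => current α f p.1 p.2.1 p.2.2)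
      (volume.restrict (macroDomain T)) :=
    AEStronglyMeasurable.smul (f := fun p : Pos × ℝ × ℝ => 2 * p.2.1 / α)
      (Measurable.aestronglyMeasurable (by fun_prop))
      (hm1.mono_ac (absolutelyContinuous_macroMeasure T))
  have hm3 := hm2.mono_measure (Measure.restrict_mono hsub le_rfl)
  rw [memLp_two_iff_integrable_sq_norm hm3]
  have hdom : IntegrableOn (fun p : Pos × ℝ × ℝ => √(2 * p.2.1) *
      ∫ y, f p.2.2 (y.1, p.1, √(2 * p.2.1) • (y.2 : Vel)) ^ 2 ∂slabSphere) (macroDomain T) :=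
    (integral_timePhase_eq hf.memLp.integrable_sq).1
  -- In the constant, `1 + 2R` bounds `√(2ε)`, `2R` bounds `2ε`, and the mass of the fibre comes
  -- from Cauchy–Schwarz.
  refine ((hdom.mono_set hsub).const_mul
    ((α⁻¹) ^ 2 * (1 + 2 * R) * (2 * R) * slabSphere.real univ)).mono' (hm3.norm.pow 2) ?_
  filter_upwards [ae_restrict_mem mD, ae_restrict_of_ae_restrict_of_subset hsub (ae_memLp_fiber hf)]
    with p hp hi
  have hε : 0 < p.2.1 := hp.2.1.1
  have hεR : p.2.1 < R := hp.2.1.2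
  have hR : 0 < R := hε.trans hεR
  rw [Real.norm_of_nonneg (by positivity), current, norm_smul, mul_pow]
  set u : ℝ × Dir → ℝ := fun y => f p.2.2 (y.1, p.1, √(2 * p.2.1) • (y.2 : Vel)) with hu
  have h1 : ‖∫ y, u y • par (y.2 : Vel) ∂slabSphere‖ ≤ ∫ y, |u y| ∂slabSphere := by
    refine norm_integral_le_of_norm_le (hi.integrable (by norm_num)).abs
      (Eventually.of_forall fun y => ?_)
    rw [norm_smul]
    exact mul_le_of_le_one_right (norm_nonneg _) (norm_par_dir_le _)
  have h2 := sq_integral_abs_le hi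
  have h3 : ‖∫ y, u y • par (y.2 : Vel) ∂slabSphere‖ ^ 2 ≤
      slabSphere.real univ * ∫ y, u y ^ 2 ∂slabSphere :=
    (pow_le_pow_left₀ (norm_nonneg _) h1 2).trans h2
  have hV : 0 ≤ slabSphere.real univ := measureReal_nonneg
  have hI : 0 ≤ ∫ y, u y ^ 2 ∂slabSphere := integral_nonneg fun y => sq_nonneg _
  have hs := Real.sq_sqrt (show 0 ≤ 2 * p.2.1 by positivity)
  have hs0 := Real.sqrt_nonneg (2 * p.2.1)
  have hsR : √(2 * p.2.1) ≤ 1 + 2 * R := by nlinarith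
  have h4 : ‖2 * p.2.1 / α‖ ^ 2 ≤ (α⁻¹) ^ 2 * (1 + 2 * R) * (2 * R) * √(2 * p.2.1) := by
    rw [Real.norm_eq_abs, sq_abs, div_eq_mul_inv, mul_pow]
    have : (2 * p.2.1) ^ 2 ≤ (1 + 2 * R) * (2 * R) * √(2 * p.2.1) := by
      calc (2 * p.2.1) ^ 2 = √(2 * p.2.1) * (2 * p.2.1) * √(2 * p.2.1) := by
            linear_combination (-(2 * p.2.1)) * hs
        _ ≤ (1 + 2 * R) * (2 * R) * √(2 * p.2.1) := by gcongr
    nlinarith [sq_nonneg α⁻¹]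
  calc ‖2 * p.2.1 / α‖ ^ 2 * ‖∫ y, u y • par (y.2 : Vel) ∂slabSphere‖ ^ 2
      ≤ ((α⁻¹) ^ 2 * (1 + 2 * R) * (2 * R) * √(2 * p.2.1)) *
        (slabSphere.real univ * ∫ y, u y ^ 2 ∂slabSphere) := by
        gcongr
    _ = _ := by ring

/-! ### Passage to the limit -/

/-- In `L²`, the pairing of a weakly and a strongly convergent sequence converges. -/
theorem tendsto_integral_inner_of_weak_of_strong {X H : Type*} [MeasurableSpace X] {μ : Measure X}
    [NormedAddCommGroup H] [InnerProductSpace ℝ H] [CompleteSpace H]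
    {u w : ℕ → X → H} {u₀ w₀ : X → H}
    (hu : ∀ n, MemLp (u n) 2 μ) (hu₀ : MemLp u₀ 2 μ) (hw : ∀ n, MemLp (w n) 2 μ)
    (hw₀ : MemLp w₀ 2 μ)
    (hweak : ∀ Ψ, MemLp Ψ 2 μ →
      Tendsto (fun n => ∫ x, inner ℝ (u n x) (Ψ x) ∂μ) atTop (𝓝 (∫ x, inner ℝ (u₀ x) (Ψ x) ∂μ)))
    (hstrong : Tendsto (fun n => eLpNorm (w n - w₀) 2 μ) atTop (𝓝 0)) :
    Tendsto (fun n => ∫ x, inner ℝ (u n x) (w n x) ∂μ) atTop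
      (𝓝 (∫ x, inner ℝ (u₀ x) (w₀ x) ∂μ)) := by
  have hinner : ∀ {a b : X → H} (ha : MemLp a 2 μ) (hb : MemLp b 2 μ),
      inner ℝ (ha.toLp a) (hb.toLp b) = ∫ x, inner ℝ (a x) (b x) ∂μ := fun ha hb => by
    rw [L2.inner_def]
    refine integral_congr_ae ?_
    filter_upwards [ha.coeFn_toLp, hb.coeFn_toLp] with x h1 h2
    rw [h1, h2]
  have hW := (Lp.tendsto_Lp_iff_tendsto_eLpNorm'' w hw w₀ hw₀).2 hstrong
  simp only [← hinner (hu _) (hw _), ← hinner hu₀ hw₀]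
  have hweak' : ∀ V : Lp H 2 μ, Tendsto (fun n => inner ℝ ((hu n).toLp (u n)) V) atTop
      (𝓝 (inner ℝ (hu₀.toLp u₀) V)) := fun V => by
    have hV := Lp.memLp V
    have h := hweak V hV
    simp only [← hinner (hu _) hV, ← hinner hu₀ hV, Lp.toLp_coeFn] at h
    exact h
  -- Weak convergence bounds each pairing in `n`; uniform boundedness then bounds the norms of the
  -- `u n`.
  obtain ⟨c, hc⟩ := banach_steinhaus (g := fun n => innerSL ℝ ((hu n).toLp (u n))) fun V => by
    obtain ⟨C, hC⟩ := (hweak' V).norm.bddAbove_range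
    exact ⟨C, fun n => hC (mem_range_self n)⟩
  -- The pairing splits as `⟨uₙ, w₀⟩ + ⟨uₙ, wₙ - w₀⟩`; the second term is at most `c ‖wₙ - w₀‖`.
  have hdiff : Tendsto (fun n => inner ℝ ((hu n).toLp (u n))
      ((hw n).toLp (w n) - hw₀.toLp w₀)) atTop (𝓝 0) := by
    have h0 : Tendsto (fun n => c * ‖(hw n).toLp (w n) - hw₀.toLp w₀‖) atTop (𝓝 0) := by
      simpa using (tendsto_iff_norm_sub_tendsto_zero.1 hW).const_mul c
    refine squeeze_zero_norm (fun n => ?_) h0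
    refine (norm_inner_le_norm _ _).trans ?_
    gcongr
    simpa using hc n
  have h := (hweak' (hw₀.toLp w₀)).add hdiff
  simpa [← inner_add_right] using h

/-- The vector `(∇_ξ + e ∂_ε)ψ`, where `L` is the derivative of `ψ`. -/
def driftVec (L : Pos × ℝ × ℝ →L[ℝ] ℝ) (e : Pos) : Pos :=
  (InnerProductSpace.toDual ℝ Pos).symm (L.comp (ContinuousLinearMap.inl ℝ Pos (ℝ × ℝ))) +
    L (0, 1, 0) • e

/-- Riesz representation puts the drift term in the form of an `L²` pairing with the current, to
which weak convergence applies. -/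
theorem inner_driftVec (L : Pos × ℝ × ℝ →L[ℝ] ℝ) (e a : Pos) :
    inner ℝ a (driftVec L e) = driftFunctional L e a := by
  rw [driftVec, inner_add_right, inner_smul_right, real_inner_comm,
    InnerProductSpace.toDual_symm_apply, driftFunctional_apply, mul_comm]
  rfl

theorem integrable_inner_of_memLp {X H : Type*} [MeasurableSpace X] {μ : Measure X}
    [NormedAddCommGroup H] [InnerProductSpace ℝ H] {u w : X → H}
    (hu : MemLp u 2 μ) (hw : MemLp w 2 μ) : Integrable (fun x => inner ℝ (u x) (w x)) μ :=
  (hu.norm.integrable_mul hw.norm).mono' (hu.1.inner hw.1)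
    (Eventually.of_forall fun _ => norm_inner_le_norm _ _)

/-- The bounded domain `{|ξ| < R} × (0, R) × (0, T)`. -/
def boxMeasure (T R : ℝ) : Measure (Pos × ℝ × ℝ) :=
  volume.restrict (Metric.ball 0 R ×ˢ Ioo 0 R ×ˢ Ioo 0 T)

theorem boxMeasure_eq_prod (T R : ℝ) : boxMeasure T R =
    (volume.restrict (Metric.ball (0 : Pos) R)).prod
      ((volume.restrict (Ioo 0 R)).prod (volume.restrict (Ioo 0 T))) := by
  rw [boxMeasure, Measure.volume_eq_prod Pos (ℝ × ℝ), ← Measure.prod_restrict,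
    Measure.volume_eq_prod ℝ ℝ, ← Measure.prod_restrict]

instance (R : ℝ) : IsFiniteMeasure ((volume : Measure Pos).restrict (Metric.ball 0 R)) :=
  ⟨by rw [Measure.restrict_apply_univ]; exact measure_ball_lt_top⟩

instance (R : ℝ) : IsFiniteMeasure ((volume : Measure ℝ).restrict (Ioo 0 R)) := ⟨by simp⟩

instance (T R : ℝ) : IsFiniteMeasure (boxMeasure T R) := by
  rw [boxMeasure_eq_prod]
  infer_instance

theorem measurePreserving_box_regroup (T R : ℝ) :
    MeasurePreserving (fun p : Pos × ℝ × ℝ => ((p.2.2, p.1), p.2.1)) (boxMeasure T R)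
      ((volume.restrict (Ioo 0 T ×ˢ Metric.ball (0 : Pos) R)).prod (volume.restrict (Ioo 0 R))) := by
  rw [boxMeasure_eq_prod, Measure.volume_eq_prod ℝ Pos, ← Measure.prod_restrict]
  exact (MeasurePreserving.symm MeasurableEquiv.prodAssoc (measurePreserving_prodAssoc _ _ _)).comp
    (measurePreserving_prod_rotate _ _ _)

theorem MemL2L2loc.memLp_box {T : ℝ} {E : ℝ → Pos → Pos} (hE : MemL2L2loc T E) (R : ℝ) :
    MemLp (fun p : Pos × ℝ × ℝ => E p.2.2 p.1) 2 (boxMeasure T R) :=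
  ((hE R).comp_fst (volume.restrict (Ioo 0 R))).comp_measurePreserving
    (measurePreserving_box_regroup T R)

/-- The field does not depend on `ε`, so integrating over `(0, R)` multiplies the squared norm by
`R`. -/
theorem eLpNorm_box {T R : ℝ} {E : ℝ × Pos → Pos}
    (hE : AEStronglyMeasurable E (volume.restrict (Ioo 0 T ×ˢ Metric.ball (0 : Pos) R))) :
    eLpNorm (fun p : Pos × ℝ × ℝ => E (p.2.2, p.1)) 2 (boxMeasure T R) =
      ENNReal.ofReal R ^ (2⁻¹ : ℝ) *
        eLpNorm E 2 (volume.restrict (Ioo 0 T ×ˢ Metric.ball (0 : Pos) R)) := by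
  have h1 := eLpNorm_comp_measurePreserving (p := 2) (hE.comp_fst (ν := volume.restrict (Ioo 0 R)))
    (measurePreserving_box_regroup T R)
  simp only [Function.comp_def] at h1
  rw [h1]
  have h2 := eLpNorm_map_measure (p := 2) (f := Prod.fst)
    (μ := (volume.restrict (Ioo 0 T ×ˢ Metric.ball (0 : Pos) R)).prod (volume.restrict (Ioo 0 R)))
    (g := E) (by rw [Measure.map_fst_prod]; exact hE.smul_measure _) (by fun_prop)
  rw [Measure.map_fst_prod, eLpNorm_smul_measure_of_ne_top (by norm_num)] at h2
  simp only [Function.comp_def] at h2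
  rw [← h2]
  simp

theorem IsTest.memLp_driftVec {T : ℝ} {ψ : Pos × ℝ × ℝ → ℝ} (hψ : IsTest T ψ)
    {E : ℝ → Pos → Pos} (hE : MemL2L2loc T E) (R : ℝ) :
    MemLp (fun p => driftVec (fderiv ℝ ψ p) (E p.2.2 p.1)) 2 (boxMeasure T R) := by
  obtain ⟨-, M, -, hM, -, hb, -, -⟩ := hψ.exists_bounds
  have hcont : Continuous (fderiv ℝ ψ) := hψ.contDiff.continuous_fderiv (by norm_num)
  have h1 : MemLp (fun p => (InnerProductSpace.toDual ℝ Pos).symm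
      ((fderiv ℝ ψ p).comp (ContinuousLinearMap.inl ℝ Pos (ℝ × ℝ)))) 2 (boxMeasure T R) := by
    refine MemLp.of_bound (Continuous.aestronglyMeasurable ?_) M (Eventually.of_forall fun p => ?_)
    · exact (LinearIsometryEquiv.continuous _).comp (hcont.clm_comp continuous_const)
    · rw [LinearIsometryEquiv.norm_map]
      refine (ContinuousLinearMap.opNorm_comp_le _ _).trans ?_
      exact (mul_le_of_le_one_right (norm_nonneg _)
        (ContinuousLinearMap.norm_inl_le_one ℝ Pos (ℝ × ℝ))).trans (hb p)
  obtain ⟨-, M', -, hb', -⟩ := hψ.exists_bounds_apply (0, 1, 0)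
  have hE' := hE.memLp_box R
  refine h1.add ((hE'.norm.const_mul M').mono
    ((continuous_fderiv_apply_const hψ _).aestronglyMeasurable.smul hE'.1)
    (Eventually.of_forall fun p => ?_))
  rw [norm_smul]
  refine (mul_le_mul_of_nonneg_right (hb' p) (norm_nonneg _)).trans (le_abs_self _)

/-- The gradient `∇_ξψ` cancels in the difference, leaving `∂_εψ (Eₙ - E)` with `∂_εψ` bounded. -/
theorem IsTest.tendsto_driftVec {T : ℝ} {ψ : Pos × ℝ × ℝ → ℝ} (hψ : IsTest T ψ)
    {Es : ℕ → ℝ → Pos → Pos} {E : ℝ → Pos → Pos} (hEs : ∀ n, MemL2L2loc T (Es n))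
    (hE : StrongL2locTendsto T Es E) (R : ℝ) :
    Tendsto (fun n => eLpNorm ((fun p => driftVec (fderiv ℝ ψ p) (Es n p.2.2 p.1)) -
      fun p => driftVec (fderiv ℝ ψ p) (E p.2.2 p.1)) 2 (boxMeasure T R)) atTop (𝓝 0) := by
  obtain ⟨-, M, -, hb, -⟩ := hψ.exists_bounds_apply (0, 1, 0)
  have h0 : Tendsto (fun n => ENNReal.ofReal M * (ENNReal.ofReal R ^ (2⁻¹ : ℝ) *
      eLpNorm (fun q : ℝ × Pos => Es n q.1 q.2 - E q.1 q.2) 2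
        (volume.restrict (Ioo 0 T ×ˢ Metric.ball 0 R)))) atTop (𝓝 0) := by
    have h := ENNReal.Tendsto.const_mul (a := ENNReal.ofReal R ^ (2⁻¹ : ℝ)) (hE.2 R)
      (Or.inr (ENNReal.rpow_ne_top_of_nonneg (by norm_num) ENNReal.ofReal_ne_top))
    have h' := ENNReal.Tendsto.const_mul (a := ENNReal.ofReal M) h
      (Or.inr ENNReal.ofReal_ne_top)
    simpa using h'
  refine tendsto_of_tendsto_of_tendsto_of_le_of_le tendsto_const_nhds h0 (fun n => zero_le)
    fun n => ?_
  simp only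
  rw [← eLpNorm_box (E := fun q => Es n q.1 q.2 - E q.1 q.2) ((hEs n R).sub (hE.1 R)).1]
  refine eLpNorm_le_mul_eLpNorm_of_ae_le_mul (Eventually.of_forall fun p => ?_) 2
  have : driftVec (fderiv ℝ ψ p) (Es n p.2.2 p.1) - driftVec (fderiv ℝ ψ p) (E p.2.2 p.1) =
      fderiv ℝ ψ p (0, 1, 0) • (Es n p.2.2 p.1 - E p.2.2 p.1) := by
    rw [driftVec, driftVec, smul_sub]
    abel
  rw [Pi.sub_apply, this, norm_smul]
  exact mul_le_mul_of_nonneg_right (hb p) (norm_nonneg _)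

/-- The drift term of the weak form lives on a bounded domain. -/
theorem IsTest.exists_box {T : ℝ} {ψ : Pos × ℝ × ℝ → ℝ} (hψ : IsTest T ψ) :
    ∃ R : ℝ, ∀ (J : Pos → ℝ → ℝ → Pos) (E : ℝ → Pos → Pos),
      (∫ p in macroDomain T, driftFunctional (fderiv ℝ ψ p) (E p.2.2 p.1) (J p.1 p.2.1 p.2.2) =
        ∫ p, inner ℝ (J p.1 p.2.1 p.2.2) (driftVec (fderiv ℝ ψ p) (E p.2.2 p.1))
          ∂boxMeasure T R) ∧
      (Integrable (fun p => inner ℝ (J p.1 p.2.1 p.2.2) (driftVec (fderiv ℝ ψ p) (E p.2.2 p.1)))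
        (boxMeasure T R) → IntegrableOn (fun p => driftFunctional (fderiv ℝ ψ p) (E p.2.2 p.1)
          (J p.1 p.2.1 p.2.2)) (macroDomain T)) := by
  obtain ⟨R, -, -, -, -, -, -, hz⟩ := hψ.exists_bounds
  refine ⟨R, fun J E => ?_⟩
  simp only [inner_driftVec]
  have hsub : (Metric.ball (0 : Pos) R) ×ˢ Ioo (0 : ℝ) R ×ˢ Ioo (0 : ℝ) T ⊆ macroDomain T :=
    prod_mono (subset_univ _) (prod_mono Ioo_subset_Ioi_self le_rfl)
  have hzero : ∀ p ∈ macroDomain T \ (Metric.ball (0 : Pos) R) ×ˢ Ioo (0 : ℝ) R ×ˢ Ioo (0 : ℝ) T,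
      driftFunctional (fderiv ℝ ψ p) (E p.2.2 p.1) (J p.1 p.2.1 p.2.2) = 0 := by
    rintro p ⟨hp, hp'⟩
    have hR : R ≤ ‖p‖ := by
      by_contra hcon
      push Not at hcon
      have h1 : ‖p.1‖ < R := (norm_fst_le p).trans_lt hcon
      have h2 : ‖p.2.1‖ < R := ((norm_fst_le p.2).trans (norm_snd_le p)).trans_lt hcon
      exact hp' ⟨by simpa using h1, ⟨hp.2.1, (le_abs_self _).trans_lt h2⟩, hp.2.2⟩
    simp [driftFunctional_apply, hz p hR]
  exact ⟨setIntegral_eq_of_subset_of_forall_sdiff_eq_zero (measurableSet_macroDomain T) hsub hzero,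
    fun h => IntegrableOn.of_forall_sdiff_eq_zero h (measurableSet_macroDomain T) hzero⟩

theorem IsTest.tendsto_avgDensity_part {T : ℝ} {ψ : Pos × ℝ × ℝ → ℝ} (hψ : IsTest T ψ)
    {fs : ℕ → ℝ → Phase → ℝ} {f₀ : ℝ → Phase → ℝ} (hf : WeakStarTendsto T fs f₀) :
    Tendsto (fun n => ∫ q : ℝ × Phase, fs n q.1 q.2 * fderiv ℝ ψ (macroPoint q.1 q.2) (0, 0, 1)
      ∂timePhaseMeasure T) atTop
      (𝓝 (∫ q : ℝ × Phase, f₀ q.1 q.2 * fderiv ℝ ψ (macroPoint q.1 q.2) (0, 0, 1)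
        ∂timePhaseMeasure T)) := by
  obtain ⟨R, M, hR, hb, hz⟩ := hψ.exists_bounds_apply (0, 0, 1)
  refine hf.2 (fun t p => fderiv ℝ ψ (macroPoint t p) (0, 0, 1)) (hψ.memLp_fderiv _).1 ?_
  refine (lintegral_mono fun t => eLpNorm_macroPoint_le hR hb hz t).trans_lt ?_
  rw [setLIntegral_const, Real.volume_Ioo]
  exact ENNReal.mul_lt_top (memLp_indicator_testRegion (R + 2) M).2 ENNReal.ofReal_lt_top

/-- The density term passes to the limit on phase space, where `fₙ` converges, and is rewritten
through `F` only afterwards; the drift term passes to the limit in the variables `(ξ, ε, t)`, where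
`Jₙ` converges. -/
theorem weakContinuityEq_of_tendsto {T : ℝ} (hT : 0 < T) {K : Pos → ℝ → Vel → Vel → ℝ}
    (hK : IsReflectionKernel K) {B C : Pos → ℝ} {FI : Pos → ℝ → ℝ}
    (hFI : MemLp (initialDatum FI) 2 phaseMeasure)
    {αs : ℕ → ℝ} {fs : ℕ → ℝ → Phase → ℝ} {φs : ℕ → ℝ → Pos → ℝ} {Es : ℕ → ℝ → Pos → Pos}
    (hs : ∀ n, IsSolution (αs n) T K B C FI (fs n) (φs n) (Es n))
    {f₀ : ℝ → Phase → ℝ} {J : Pos → ℝ → ℝ → Pos} {E : ℝ → Pos → Pos}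
    (hf : WeakStarTendsto T fs f₀)
    (hJ : WeakL2locTendsto T (fun n => current (αs n) (fs n)) J)
    (hE : StrongL2locTendsto T Es E) :
    WeakContinuityEq T (avgDensity f₀) J E FI := by
  intro ψ hψ
  obtain ⟨i1, e1⟩ := avgDensity_part hf.1 hψ
  obtain ⟨i3, e3⟩ := initial_part hFI hψ
  -- The radius depends on `ψ` alone, so one box serves all `n` and the limit.
  obtain ⟨R, hbox⟩ := hψ.exists_box
  have hw := hψ.memLp_driftVec hE.1 R
  have hJR : MemLp (fun p : Pos × ℝ × ℝ => J p.1 p.2.1 p.2.2) 2 (boxMeasure T R) := (hJ R).1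
  have i2 := (hbox J E).2 (integrable_inner_of_memLp hJR hw)
  have hlim := tendsto_integral_inner_of_weak_of_strong (μ := boxMeasure T R)
    (u := fun n (p : Pos × ℝ × ℝ) => current (αs n) (fs n) p.1 p.2.1 p.2.2)
    (fun n => current_memLp (hs n).memLp R) hJR
    (fun n => hψ.memLp_driftVec (hs n).field R) hw (hJ R).2
    (hψ.tendsto_driftVec (fun n => (hs n).field) hE R)
  rw [← (hbox J E).1] at hlim
  have hlim' := hlim.congr fun n => (hbox (current (αs n) (fs n)) (Es n)).1.symm
  have hsum := ((hψ.tendsto_avgDensity_part hf).add hlim').add_const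
    (∫ p, initialDatum FI p * ψ (macroPoint 0 p) ∂phaseMeasure)
  have hzero : ∀ n, (∫ q : ℝ × Phase, fs n q.1 q.2 * fderiv ℝ ψ (macroPoint q.1 q.2) (0, 0, 1)
      ∂timePhaseMeasure T) + (∫ p in macroDomain T, driftFunctional (fderiv ℝ ψ p)
        (Es n p.2.2 p.1) (current (αs n) (fs n) p.1 p.2.1 p.2.2)) +
      (∫ p, initialDatum FI p * ψ (macroPoint 0 p) ∂phaseMeasure) = 0 := fun n => by
    rw [(current_part (hs n).memLp (hs n).field hψ).2]
    exact phase_weak_form hT hK hFI (hs n) hψ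
  have key := tendsto_nhds_unique (hsum.congr hzero) tendsto_const_nhds
  rw [← e1, ← e3] at key
  rw [weakIntegrand_eq]
  exact ⟨i1.add i2, i3, (congrArg₂ (· + ·) (integral_add i1 i2) rfl).trans key⟩

end SHE

end

theorem mainTheorem6 (T : ℝ) (hT : 0 < T)
    (K : SHE.Pos → ℝ → SHE.Vel → SHE.Vel → ℝ) (hK : SHE.IsReflectionKernel K)
    (B : SHE.Pos → ℝ) (hB : Continuous B)
    (C : SHE.Pos → ℝ) (hC : LocallyIntegrable C)
    (FI : SHE.Pos → ℝ → ℝ) (hFI : MemLp (SHE.initialDatum FI) 2 SHE.phaseMeasure) :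
    (∀ (α : ℝ), 0 < α →
      ∀ (f : ℝ → SHE.Phase → ℝ) (φ : ℝ → SHE.Pos → ℝ) (E : ℝ → SHE.Pos → SHE.Pos),
        SHE.IsSolution α T K B C FI f φ E →
        SHE.WeakContinuityEq T (SHE.avgDensity f) (SHE.current α f) E FI) ∧
    (∀ (αs : ℕ → ℝ), (∀ n, 0 < αs n) → Tendsto αs atTop (𝓝 0) →
      ∀ (fs : ℕ → ℝ → SHE.Phase → ℝ) (φs : ℕ → ℝ → SHE.Pos → ℝ)
        (Es : ℕ → ℝ → SHE.Pos → SHE.Pos),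
        (∀ n, SHE.IsSolution (αs n) T K B C FI (fs n) (φs n) (Es n)) →
      ∀ (f₀ : ℝ → SHE.Phase → ℝ) (J : SHE.Pos → ℝ → ℝ → SHE.Pos) (E : ℝ → SHE.Pos → SHE.Pos),
        SHE.WeakStarTendsto T fs f₀ →
        SHE.WeakL2locTendsto T (fun n => SHE.current (αs n) (fs n)) J →
        SHE.StrongL2locTendsto T Es E →
        SHE.WeakContinuityEq T (SHE.avgDensity f₀) J E FI) := by
  exact ⟨fun α _ f φ E hs => hs.weakContinuityEq hT hK hFI,
    fun αs _ _ fs φs Es hs f₀ J E hf hJ hE =>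
      SHE.weakContinuityEq_of_tendsto hT hK hFI hs hf hJ hE⟩
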